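/- Let $d\ge 1$, let $\|\cdot\|$ be any norm on $\mathbb{R}^d$, and let $|\cdot|$ be the Euclidean norm. Let $S_1,\dots,S_p:\mathbb{R}^d\to\mathbb{R}^d$ be contractive similitudes, i.e. $|S_i(x)-S_i(y)|=\alpha_i|x-y|$ for all $x,y$ with $0<\alpha_i<1$, satisfying the open set condition: there is a non-empty open set $U\subset\mathbb{R}^d$ with $S_i(U)\subset U$ for all $i$ and $S_i(U)\cap S_j(U)=\emptyset$ for $i\ne j$. Let $K$ be the associated self-similar set, i.e. the non-empty compact set with $K=\bigcup_{i=1}^p S_i(K)$, and let $s=\dim_H K$ be its Hausdorff dimension. Let $\mathcal{M}(K)$ be the space of Borel probability measures on $K$ with the weak topology. For $\mu\in\mathcal{M}(K)$ and $x\in K$ let $$h_\mu(x)=\liminf_{r\to0^+}\frac{\log\mu(B(x,r))}{\log r}\in[0,+\infty],\qquad B(x,r)=\{y\in K:\|y-x\|<r\},\quad \log 0=-\infty,$$ $E_\mu(h)=\{x\in K: h_\mu(x)=h\}$ and $d_\mu(h)=\dim_H E_\mu(h)$. For $j\ge1$ let $\mathcal{G}_j$ be the set of dyadic cubes $\prod_{i=1}^d[k_i2^{-j},(k_i+1)2^{-j})$,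 $k\in\mathbb{Z}^d$, and for $q\in\mathbb{R}$, $h\ge 0$ let $$\tau_\mu(q)=\liminf_{j\to+\infty}-\frac{\log\sum_{Q\in\mathcal{G}_j,\ \mu(Q)\ne0}\mu(Q)^q}{j\log2},\qquad \tau_\mu^*(h)=\inf_{q\in\mathbb{R}}\bigl(qh-\tau_\mu(q)\bigr).$$ Then there is a dense $G_\delta$ set $\Omega\subset\mathcal{M}(K)$ such that for every $\mu\in\Omega$: 1. $E_\mu(h)=\emptyset$ for all $h\in(s,+\infty]$; 2. $E_\mu(h)\neq\emptyset$ and $d_\mu(h)=h$ for all $h\in[0,s]$; 3. $\tau_\mu(q)=s(q-1)$ for all $q\in[0,1]$; 4. $\mu$ satisfies the multifractal formalism at every $h\in[0,s]$, i.e. $d_\mu(h)=\tau_\mu^*(h)$. -/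

import Mathlib

open Set Filter Topology MeasureTheory
open scoped NNReal ENNReal

noncomputable section

/-- `S` is a contractive similitude of `ℝ^d` (Euclidean norm) with ratio `α ∈ (0, 1)`. -/
def IsContractiveSimilitude {d : ℕ} (α : ℝ)
    (S : EuclideanSpace ℝ (Fin d) → EuclideanSpace ℝ (Fin d)) : Prop :=
  0 < α ∧ α < 1 ∧ ∀ x y, ‖S x - S y‖ = α * ‖x - y‖

/-- `K` is the self-similar set of the finite family `S`: the non-empty compact set with
`K = ⋃ i, S i (K)`. -/
def IsSelfSimilarSet {d p : ℕ}
    (S : Fin p → EuclideanSpace ℝ (Fin d) → EuclideanSpace ℝ (Fin d))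
    (K : Set (EuclideanSpace ℝ (Fin d))) : Prop :=
  K.Nonempty ∧ IsCompact K ∧ K = ⋃ i, S i '' K

/-- The open set condition for the family `S`. -/
def OpenSetCondition {d p : ℕ}
    (S : Fin p → EuclideanSpace ℝ (Fin d) → EuclideanSpace ℝ (Fin d)) : Prop :=
  ∃ U : Set (EuclideanSpace ℝ (Fin d)), IsOpen U ∧ U.Nonempty ∧
    (∀ i, S i '' U ⊆ U) ∧ ∀ i j, i ≠ j → S i '' U ∩ S j '' U = ∅

/-- The local Hölder exponent `h_μ(x) = liminf_{r → 0+} log μ(B(x, r)) / log r`, where the balls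
of `K` are those of the norm `N`.  It takes values in the extended reals, with `log 0 = -∞`. -/
def localHolderExponent {d : ℕ} (N : Seminorm ℝ (EuclideanSpace ℝ (Fin d)))
    {K : Set (EuclideanSpace ℝ (Fin d))} (μ : ProbabilityMeasure K) (x : K) : EReal :=
  liminf (fun r : ℝ =>
      ENNReal.log ((μ : Measure K) {y : K | N ((y : EuclideanSpace ℝ (Fin d)) - x) < r}) /
        ((Real.log r : ℝ) : EReal))
    (𝓝[>] (0 : ℝ))

/-- The level set `E_μ(h) = {x ∈ K : h_μ(x) = h}`. -/
def levelSet {d : ℕ} (N : Seminorm ℝ (EuclideanSpace ℝ (Fin d)))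
    {K : Set (EuclideanSpace ℝ (Fin d))} (μ : ProbabilityMeasure K) (h : EReal) :
    Set (EuclideanSpace ℝ (Fin d)) :=
  {x | ∃ hx : x ∈ K, localHolderExponent N μ ⟨x, hx⟩ = h}

/-- The singularity spectrum `d_μ(h) = dim_H E_μ(h)`. -/
def singularitySpectrum {d : ℕ} (N : Seminorm ℝ (EuclideanSpace ℝ (Fin d)))
    {K : Set (EuclideanSpace ℝ (Fin d))} (μ : ProbabilityMeasure K) (h : EReal) : ℝ≥0∞ :=
  dimH (levelSet N μ h)

/-- The half-open dyadic cube `∏ i, [k_i 2^{-j}, (k_i + 1) 2^{-j})`. -/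
def dyadicCube {d : ℕ} (j : ℕ) (k : Fin d → ℤ) : Set (EuclideanSpace ℝ (Fin d)) :=
  {x | ∀ i, (k i : ℝ) * ((2 : ℝ) ^ j)⁻¹ ≤ x i ∧ x i < ((k i : ℝ) + 1) * ((2 : ℝ) ^ j)⁻¹}

/-- The mass `μ(Q ∩ K)` of the dyadic cube `Q` of generation `j` and index `k`. -/
def cubeMass {d : ℕ} {K : Set (EuclideanSpace ℝ (Fin d))} (μ : ProbabilityMeasure K)
    (j : ℕ) (k : Fin d → ℤ) : ℝ≥0∞ :=
  (μ : Measure K) {y : K | (y : EuclideanSpace ℝ (Fin d)) ∈ dyadicCube j k}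

/-- The sum of `μ(Q)^q` over the dyadic cubes `Q` of generation `j` with `μ(Q) ≠ 0`. -/
def partitionSum {d : ℕ} {K : Set (EuclideanSpace ℝ (Fin d))} (μ : ProbabilityMeasure K)
    (q : ℝ) (j : ℕ) : ℝ≥0∞ :=
  ∑' k : {k : Fin d → ℤ // cubeMass μ j k ≠ 0}, cubeMass μ j k ^ q

/-- The `L^q` spectrum
`τ_μ(q) = liminf_{j → ∞} -(log ∑_{Q, μ(Q) ≠ 0} μ(Q)^q) / (j log 2)`, an extended real. -/
def lqSpectrum {d : ℕ} {K : Set (EuclideanSpace ℝ (Fin d))} (μ : ProbabilityMeasure K)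
    (q : ℝ) : EReal :=
  liminf (fun j : ℕ => -ENNReal.log (partitionSum μ q j) / (((j : ℝ) * Real.log 2 : ℝ) : EReal))
    atTop

/-- The Legendre transform `(τ_μ)^*(h) = inf_{q ∈ ℝ} (q h - τ_μ(q))`. -/
def lqLegendre {d : ℕ} {K : Set (EuclideanSpace ℝ (Fin d))} (μ : ProbabilityMeasure K)
    (h : ℝ) : EReal :=
  ⨅ q : ℝ, (((q * h : ℝ) : EReal) - lqSpectrum μ q)

/-- `μ` satisfies the multifractal formalism at `h`: `d_μ(h) = (τ_μ)^*(h)`. -/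
def MultifractalFormalismAt {d : ℕ} (N : Seminorm ℝ (EuclideanSpace ℝ (Fin d)))
    {K : Set (EuclideanSpace ℝ (Fin d))} (μ : ProbabilityMeasure K) (h : ℝ) : Prop :=
  ((singularitySpectrum N μ (h : EReal) : ℝ≥0∞) : EReal) = lqLegendre μ h

end

/-!
The points of `K` are coded by sequences `ω` of letters: `ω` codes the common point of the pieces
`S (ω 0) ∘ ⋯ ∘ S (ω (n - 1)) (K)`. If `∑ i, α i ^ s = 1`, the Bernoulli measure with weights
`α i ^ s` gives mass `ratio ^ s` to a cylinder of contraction ratio `ratio`. Under the open set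
condition a set of diameter `r` meets a bounded number of pieces of size about `r`
(`exists_cylinder_cover`). Hence bounds on the probabilities of cylinders turn into bounds for the
mass of small sets, and by the mass distribution principle into the avoidance of all sets of small
dimension (`bernoulli_eq_zero_of_dimH_lt`). For the Bernoulli measure itself this gives
`dim K = s`.

A typical measure `μ` has two properties for infinitely many `n`. It gives mass more than
`ratio w ^ s / (n + 1)` to a tiny ball around the point coded by each word `w` of length `n`
continued by a fixed letter, and mass more than a proportion `1 / (n + 1)` of the natural measure to
every enlarged dyadic cube of generation `n` with positive natural mass. These are open conditions, and they hold for mixtures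
of any given measure with a proportion `2 / (n + 2)` of the sum of the atoms, respectively of the
natural measure; so they define a dense `Gδ` set by the Baire property of the compact space of
probability measures.

* Every point of `K` lies in a piece of each order, so that the atoms in these pieces give
  `h_μ ≤ s` everywhere.
* The set of points of exponent less than `t` has dimension at most `t` for every measure, by
  counting the dyadic cubes of mass at least `2 ^ (-j t)`.
* For `0 < h ≤ s`, consider a Bernoulli code that, at rare times `N k`, waits near an atom: it
  repeats the fixed letter until its ratio has dropped to the power `β k` of its value at time
  `N k`, where `β k` tends to `s / h`. The coded point has exponent at most `h`
  (`localHolderExponent_force_le`). If `N k` grows fast, its cylinder probabilities are at most a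
  constant times `ratio ^ h'` for every `h' < h` (`exists_cylBound_le`), so that the point almost
  surely avoids the points of exponent less than `h`, and no set of dimension less than `h` carries
  its law. For `h = 0` the same construction gives a point of exponent zero.
* The number of dyadic cubes meeting `K` bounds the partition sums from above for `q ∈ [0, 1]`;
  the comparison with the natural measure bounds them from below. So `τ_μ(q) = s (q - 1)` there.
  Since at least half of any `n` cubes have mass at most `2 / n`, the case `q = 0` gives
  `τ_μ(q) ≤ s (q - 1)` for `q < 0`, and the atoms give `τ_μ(q) ≤ 0` for `q > 1`;
  the Legendre transform at `h ∈ [0, s]` is therefore attained at `q = 1` and equals `h`.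
-/

noncomputable section

/-! ### Coding the self-similar set by sequences -/

/-- The self-similar set `K` of a family of contractive similitudes satisfying the open set
condition, together with the similarity dimension `s`, the solution of `∑ i, α i ^ s = 1`. -/
structure SelfSimilarSystem (d p : ℕ) where
  S : Fin p → EuclideanSpace ℝ (Fin d) → EuclideanSpace ℝ (Fin d)
  α : Fin p → ℝ
  K : Set (EuclideanSpace ℝ (Fin d))
  s : ℝ
  similitude : ∀ i, IsContractiveSimilitude (α i) (S i)
  osc : OpenSetCondition S
  selfSimilar : IsSelfSimilarSet S K
  s_nonneg : 0 ≤ s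
  moran : ∑ i, α i ^ s = 1

namespace SelfSimilarSystem

variable {d p : ℕ} (F : SelfSimilarSystem d p)

lemma α_pos (i : Fin p) : 0 < F.α i := (F.similitude i).1

lemma α_lt_one (i : Fin p) : F.α i < 1 := (F.similitude i).2.1

lemma nonempty_fin (F : SelfSimilarSystem d p) : Nonempty (Fin p) := by
  obtain ⟨x, hx⟩ := F.selfSimilar.1
  rw [F.selfSimilar.2.2] at hx
  obtain ⟨i, -⟩ := mem_iUnion.1 hx
  exact ⟨i⟩

/-- A fixed letter of the alphabet, used to extend finite words to infinite ones. -/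
def letter : Fin p := Classical.choice F.nonempty_fin

lemma exists_bounds : ∃ a b : ℝ, 0 < a ∧ b < 1 ∧ ∀ i, a ≤ F.α i ∧ F.α i ≤ b := by
  have := F.nonempty_fin
  obtain ⟨i, hi⟩ := Finite.exists_min F.α
  obtain ⟨j, hj⟩ := Finite.exists_max F.α
  exact ⟨F.α i, F.α j, F.α_pos i, F.α_lt_one j, fun k => ⟨hi k, hj k⟩⟩

/-- A positive lower bound of the contraction ratios. -/
def amin : ℝ := F.exists_bounds.choose

/-- An upper bound of the contraction ratios that is smaller than one. -/
def amax : ℝ := F.exists_bounds.choose_spec.choose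

lemma amin_pos : 0 < F.amin := F.exists_bounds.choose_spec.choose_spec.1

lemma amax_lt_one : F.amax < 1 := F.exists_bounds.choose_spec.choose_spec.2.1

lemma amin_le (i : Fin p) : F.amin ≤ F.α i := (F.exists_bounds.choose_spec.choose_spec.2.2 i).1

lemma le_amax (i : Fin p) : F.α i ≤ F.amax := (F.exists_bounds.choose_spec.choose_spec.2.2 i).2

lemma amax_pos : 0 < F.amax := (F.α_pos F.letter).trans_le (F.le_amax _)

lemma amin_lt_one : F.amin < 1 := (F.amin_le F.letter).trans_lt (F.α_lt_one _)

/-- The contraction ratio of the word formed by the first `n` letters of `ω`. -/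
def ratio (ω : ℕ → Fin p) (n : ℕ) : ℝ := ∏ i ∈ Finset.range n, F.α (ω i)

/-- The similitude `S (ω 0) ∘ ⋯ ∘ S (ω (n - 1))` of the word formed by the first `n` letters. -/
def comp (ω : ℕ → Fin p) : ℕ → EuclideanSpace ℝ (Fin d) → EuclideanSpace ℝ (Fin d)
  | 0 => id
  | n + 1 => comp ω n ∘ F.S (ω n)

@[simp] lemma ratio_zero (ω : ℕ → Fin p) : F.ratio ω 0 = 1 := by simp [ratio]

lemma ratio_succ (ω : ℕ → Fin p) (n : ℕ) : F.ratio ω (n + 1) = F.ratio ω n * F.α (ω n) :=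
  Finset.prod_range_succ _ _

lemma ratio_pos (ω : ℕ → Fin p) (n : ℕ) : 0 < F.ratio ω n :=
  Finset.prod_pos fun _ _ => F.α_pos _

lemma ratio_antitone (ω : ℕ → Fin p) : Antitone (F.ratio ω) :=
  antitone_nat_of_succ_le fun n => by
    rw [ratio_succ]
    exact mul_le_of_le_one_right (F.ratio_pos ω n).le (F.α_lt_one _).le

lemma ratio_le_one (ω : ℕ → Fin p) (n : ℕ) : F.ratio ω n ≤ 1 := by
  simpa using F.ratio_antitone ω (Nat.zero_le n)

lemma ratio_le_pow (ω : ℕ → Fin p) (n : ℕ) : F.ratio ω n ≤ F.amax ^ n := by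
  exact (Finset.prod_le_prod (fun i _ => (F.α_pos _).le) fun i _ => F.le_amax _).trans (by simp)

lemma pow_le_ratio (ω : ℕ → Fin p) (n : ℕ) : F.amin ^ n ≤ F.ratio ω n := by
  calc F.amin ^ n = ∏ i ∈ Finset.range n, F.amin := by simp
    _ ≤ _ := Finset.prod_le_prod (fun i _ => F.amin_pos.le) fun i _ => F.amin_le _

lemma ratio_mul_amin_le (ω : ℕ → Fin p) (n : ℕ) :
    F.ratio ω n * F.amin ≤ F.ratio ω (n + 1) := by
  rw [ratio_succ]
  exact mul_le_mul_of_nonneg_left (F.amin_le _) (F.ratio_pos ω n).le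

lemma tendsto_amax_pow : Tendsto (fun n : ℕ => F.amax ^ n) atTop (𝓝 0) :=
  tendsto_pow_atTop_nhds_zero_of_lt_one F.amax_pos.le F.amax_lt_one

lemma tendsto_ratio (ω : ℕ → Fin p) : Tendsto (F.ratio ω) atTop (𝓝 0) :=
  squeeze_zero (fun n => (F.ratio_pos ω n).le) (F.ratio_le_pow ω) F.tendsto_amax_pow

lemma ratio_congr {ω ω' : ℕ → Fin p} {n : ℕ} (h : ∀ i < n, ω i = ω' i) :
    F.ratio ω n = F.ratio ω' n :=
  Finset.prod_congr rfl fun i hi => by rw [h i (Finset.mem_range.1 hi)]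

lemma comp_congr {ω ω' : ℕ → Fin p} {n : ℕ} (h : ∀ i < n, ω i = ω' i) :
    F.comp ω n = F.comp ω' n := by
  induction n with
  | zero => rfl
  | succ n ih => simp only [comp, ih fun i hi => h i (by omega), h n (by omega)]

lemma norm_comp_sub (ω : ℕ → Fin p) (n : ℕ) (x y : EuclideanSpace ℝ (Fin d)) :
    ‖F.comp ω n x - F.comp ω n y‖ = F.ratio ω n * ‖x - y‖ := by
  induction n generalizing x y with
  | zero => simp [comp]
  | succ n ih =>
    simp only [comp, Function.comp_apply]
    rw [ih, (F.similitude (ω n)).2.2, ratio_succ, mul_assoc]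

lemma comp_injective (ω : ℕ → Fin p) (n : ℕ) : Function.Injective (F.comp ω n) := by
  intro x y h
  have := F.norm_comp_sub ω n x y
  rw [h, sub_self, norm_zero, zero_eq_mul] at this
  exact sub_eq_zero.1 (norm_eq_zero.1 (this.resolve_left (F.ratio_pos ω n).ne'))

lemma continuous_comp (ω : ℕ → Fin p) (n : ℕ) : Continuous (F.comp ω n) := by
  refine (LipschitzWith.of_dist_le_mul (K := ⟨F.ratio ω n, (F.ratio_pos ω n).le⟩) ?_).continuous
  intro x y
  rw [dist_eq_norm, dist_eq_norm, norm_comp_sub]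
  rfl

/-- A similitude of `ℝ^d` is affine with invertible linear part, hence surjective. -/
lemma S_surjective (i : Fin p) : Function.Surjective (F.S i) := by
  obtain ⟨h0, -, h⟩ := F.similitude i
  have hi : Isometry fun x => (F.α i)⁻¹ • F.S i x := by
    refine Isometry.of_dist_eq fun x y => ?_
    rw [dist_eq_norm, dist_eq_norm, ← smul_sub, norm_smul, h, norm_inv, Real.norm_of_nonneg h0.le]
    field_simp
  have hs : Function.Surjective hi.affineIsometryOfStrictConvexSpace := by
    rw [← AffineIsometry.coe_toAffineMap, ← AffineMap.linear_surjective_iff]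
    exact (LinearMap.injective_iff_surjective).1
      hi.affineIsometryOfStrictConvexSpace.linearIsometry.injective
  intro y
  obtain ⟨x, hx⟩ := hs ((F.α i)⁻¹ • y)
  refine ⟨x, ?_⟩
  simp only [Isometry.coe_affineIsometryOfStrictConvexSpace] at hx
  exact smul_right_injective _ (inv_ne_zero h0.ne') hx

lemma comp_surjective (ω : ℕ → Fin p) (n : ℕ) : Function.Surjective (F.comp ω n) := by
  induction n with
  | zero => exact Function.surjective_id
  | succ n ih => exact ih.comp (F.S_surjective _)

lemma ball_subset_comp_image (ω : ℕ → Fin p) (n : ℕ) (a : EuclideanSpace ℝ (Fin d)) (c : ℝ) :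
    Metric.ball (F.comp ω n a) (F.ratio ω n * c) ⊆ F.comp ω n '' Metric.ball a c := by
  intro y hy
  obtain ⟨x, rfl⟩ := F.comp_surjective ω n y
  refine ⟨x, ?_, rfl⟩
  rw [mem_ball_iff_norm, norm_comp_sub] at hy
  rw [mem_ball_iff_norm]
  exact lt_of_mul_lt_mul_left hy (F.ratio_pos ω n).le

lemma mapsTo_S (i : Fin p) : MapsTo (F.S i) F.K F.K := by
  intro x hx
  rw [F.selfSimilar.2.2]
  exact mem_iUnion.2 ⟨i, x, hx, rfl⟩

lemma comp_image_succ_subset {A : Set (EuclideanSpace ℝ (Fin d))} (hA : ∀ i, F.S i '' A ⊆ A)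
    (ω : ℕ → Fin p) (n : ℕ) : F.comp ω (n + 1) '' A ⊆ F.comp ω n '' A := by
  rw [comp, image_comp]
  exact image_mono (hA _)

lemma comp_image_antitone {A : Set (EuclideanSpace ℝ (Fin d))} (hA : ∀ i, F.S i '' A ⊆ A)
    (ω : ℕ → Fin p) : Antitone fun n => F.comp ω n '' A :=
  antitone_nat_of_succ_le (F.comp_image_succ_subset hA ω)

lemma exists_mem_iInter (ω : ℕ → Fin p) : ∃ x, ∀ n, x ∈ F.comp ω n '' F.K := by
  have hc : ∀ n, IsCompact (F.comp ω n '' F.K) := fun n =>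
    F.selfSimilar.2.1.image (F.continuous_comp ω n)
  have := IsCompact.nonempty_iInter_of_sequence_nonempty_isCompact_isClosed
    (fun n => F.comp ω n '' F.K)
    (fun n => F.comp_image_succ_subset (fun i => (F.mapsTo_S i).image_subset) ω n)
    (fun n => F.selfSimilar.1.image _) (hc 0) (fun n => (hc n).isClosed)
  obtain ⟨x, hx⟩ := this
  exact ⟨x, fun n => mem_iInter.1 hx n⟩

/-- The point of `K` coded by the sequence `ω`, the unique common point of the decreasing sets
`F.comp ω n '' K`. -/
def point (ω : ℕ → Fin p) : F.K :=
  ⟨(F.exists_mem_iInter ω).choose, by simpa [comp] using (F.exists_mem_iInter ω).choose_spec 0⟩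

lemma point_mem (ω : ℕ → Fin p) (n : ℕ) :
    (F.point ω : EuclideanSpace ℝ (Fin d)) ∈ F.comp ω n '' F.K :=
  (F.exists_mem_iInter ω).choose_spec n

/-- A number larger than the diameter of `K`. -/
def size : ℝ := Metric.diam F.K + 1

lemma one_le_size : 1 ≤ F.size := le_add_of_nonneg_left Metric.diam_nonneg

lemma size_pos : 0 < F.size := one_pos.trans_le F.one_le_size

lemma norm_sub_le_of_mem_comp {ω : ℕ → Fin p} {n : ℕ} {x y : EuclideanSpace ℝ (Fin d)}
    (hx : x ∈ F.comp ω n '' F.K) (hy : y ∈ F.comp ω n '' F.K) :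
    ‖x - y‖ ≤ F.size * F.ratio ω n := by
  obtain ⟨x, hx, rfl⟩ := hx
  obtain ⟨y, hy, rfl⟩ := hy
  rw [norm_comp_sub, mul_comm, ← dist_eq_norm]
  refine mul_le_mul_of_nonneg_right ?_ (F.ratio_pos ω n).le
  exact (Metric.dist_le_diam_of_mem F.selfSimilar.2.1.isBounded hx hy).trans (by simp [size])

lemma norm_point_sub_le {ω ω' : ℕ → Fin p} {n : ℕ} (h : ∀ i < n, ω i = ω' i) :
    ‖(F.point ω : EuclideanSpace ℝ (Fin d)) - F.point ω'‖ ≤ F.size * F.ratio ω n :=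
  F.norm_sub_le_of_mem_comp (F.point_mem ω n) (by
    rw [F.comp_congr h]
    exact F.point_mem ω' n)

lemma continuous_point : Continuous F.point := by
  rw [continuous_iff_continuousAt]
  intro ω
  refine Metric.tendsto_nhds.2 fun ε hε => ?_
  have h1 : Tendsto (fun n => F.size * F.ratio ω n) atTop (𝓝 0) := by
    simpa using (F.tendsto_ratio ω).const_mul F.size
  obtain ⟨n, hn⟩ := (h1.eventually (gt_mem_nhds hε)).exists
  have hU : {ω' : ℕ → Fin p | ∀ i < n, ω i = ω' i} ∈ 𝓝 ω := by
    have : {ω' : ℕ → Fin p | ∀ i < n, ω i = ω' i} = ⋂ i ∈ Finset.range n, {ω' | ω i = ω' i} := by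
      ext; simp
    rw [this, Filter.biInter_finset_mem]
    intro i _
    exact (continuous_apply i).continuousAt.preimage_mem_nhds (t := {x | ω i = x})
      (by simp)
  filter_upwards [hU] with ω' h'
  rw [dist_comm, Subtype.dist_eq, dist_eq_norm]
  exact (F.norm_point_sub_le h').trans_lt hn

lemma point_surjective : Function.Surjective F.point := by
  have h1 : ∀ x : F.K, ∃ q : Fin p × F.K, F.S q.1 q.2.1 = x.1 := by
    rintro ⟨x, hx⟩
    have hx' := hx
    rw [F.selfSimilar.2.2] at hx'
    obtain ⟨i, y, hy, rfl⟩ := mem_iUnion.1 hx'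
    exact ⟨(i, ⟨y, hy⟩), rfl⟩
  choose g hg using h1
  intro x
  let u : ℕ → F.K := fun n => Nat.rec x (fun _ y => (g y).2) n
  have hu : ∀ n, u (n + 1) = (g (u n)).2 := fun n => rfl
  let ω : ℕ → Fin p := fun n => (g (u n)).1
  have h2 : ∀ n, F.comp ω n (u n).1 = x.1 := by
    intro n
    induction n with
    | zero => rfl
    | succ n ih =>
      simp only [comp, Function.comp_apply, hu]
      rw [show F.S (ω n) (g (u n)).2.1 = (u n).1 from hg (u n), ih]
  refine ⟨ω, ?_⟩
  have h3 : Tendsto (fun n => F.size * F.ratio ω n) atTop (𝓝 0) := by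
    simpa using (F.tendsto_ratio ω).const_mul F.size
  have h4 : ‖(F.point ω : EuclideanSpace ℝ (Fin d)) - x‖ ≤ 0 :=
    ge_of_tendsto' h3 fun n =>
      F.norm_sub_le_of_mem_comp (F.point_mem ω n) ⟨(u n).1, (u n).2, h2 n⟩
  exact Subtype.ext (sub_eq_zero.1 (norm_le_zero_iff.1 h4))

end SelfSimilarSystem

namespace SelfSimilarSystem

variable {d p : ℕ} (F : SelfSimilarSystem d p)

/-! ### Separation of pieces under the open set condition -/

/-- Under the open set condition the images of a suitable point under the maps of two incomparable
words are separated by a fixed proportion of the contraction ratio. -/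
lemma exists_separated_center : ∃ (a : EuclideanSpace ℝ (Fin d)) (c : ℝ), 0 < c ∧
    ∀ (ω ω' : ℕ → Fin p) (n n' : ℕ), (∃ i, i < n ∧ i < n' ∧ ω i ≠ ω' i) →
      F.ratio ω n * c ≤ ‖F.comp ω' n' a - F.comp ω n a‖ := by
  classical
  obtain ⟨U, hUo, ⟨a, ha⟩, hUS, hUd⟩ := F.osc
  obtain ⟨c, hc, hcU⟩ := Metric.isOpen_iff.1 hUo a ha
  refine ⟨a, c, hc, ?_⟩
  intro ω ω' n n' hex
  by_contra! hlt
  -- The point `comp ω' n' a` lies in the images of `U` under both words.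
  have h1 : F.comp ω' n' a ∈ F.comp ω n '' U :=
    image_mono hcU (F.ball_subset_comp_image ω n a c (mem_ball_iff_norm.2 hlt))
  have h2 : F.comp ω' n' a ∈ F.comp ω' n' '' U := ⟨a, ha, rfl⟩
  -- At the first letter where the words differ, these images are disjoint.
  obtain ⟨hin, hin', hne⟩ := Nat.find_spec hex
  have hagree : ∀ j < Nat.find hex, ω j = ω' j := fun j hj => by
    by_contra hj'
    exact Nat.find_min hex hj ⟨hj.trans hin, hj.trans hin', hj'⟩
  set i := Nat.find hex
  obtain ⟨u, hu, hu'⟩ := F.comp_image_antitone hUS ω (Nat.succ_le_of_lt hin) h1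
  obtain ⟨v, hv, hv'⟩ := F.comp_image_antitone hUS ω' (Nat.succ_le_of_lt hin') h2
  rw [← hv'] at hu'
  simp only [comp, Function.comp_apply, ← F.comp_congr hagree] at hu'
  have h3 := F.comp_injective ω i hu'
  have h4 : F.S (ω i) u ∈ F.S (ω i) '' U ∩ F.S (ω' i) '' U := ⟨⟨u, hu, rfl⟩, ⟨v, hv, h3.symm⟩⟩
  rw [hUd _ _ hne] at h4
  exact h4

lemma exists_ratio_le (ω : ℕ → Fin p) {r : ℝ} (hr : 0 < r) : ∃ n, F.ratio ω n ≤ r :=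
  (((F.tendsto_ratio ω).eventually (gt_mem_nhds hr)).exists).imp fun _ h => h.le

/-- Cutting `ω` at the first time its ratio falls below `r`. -/
lemma exists_stopping (ω : ℕ → Fin p) {r : ℝ} (hr : 0 < r) (hr1 : r < 1) :
    ∃ n, F.ratio ω n ≤ r ∧ r * F.amin ≤ F.ratio ω n ∧ ∀ m < n, r < F.ratio ω m := by
  classical
  have h := F.exists_ratio_le ω hr
  refine ⟨Nat.find h, Nat.find_spec h, ?_, fun m hm => not_le.1 (Nat.find_min h hm)⟩
  have h0 : Nat.find h ≠ 0 := fun h0 => by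
    have := Nat.find_spec h
    rw [h0, ratio_zero] at this
    exact this.not_gt hr1
  obtain ⟨m, hm⟩ := Nat.exists_eq_succ_of_ne_zero h0
  have hm' : r < F.ratio ω m := not_le.1 (Nat.find_min h (hm ▸ Nat.lt_succ_self m))
  rw [hm]
  exact (mul_le_mul_of_nonneg_right hm'.le F.amin_pos.le).trans (F.ratio_mul_amin_le ω m)

/-- A set of diameter `r` meets a bounded number of cylinder pieces of size comparable to `r`. -/
lemma exists_cylinder_cover : ∃ M : ℕ, ∀ r : ℝ, 0 < r → r < 1 →
    ∀ V : Set (EuclideanSpace ℝ (Fin d)), (∀ x ∈ V, ∀ y ∈ V, ‖x - y‖ ≤ r) →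
    ∃ W : Finset ((ℕ → Fin p) × ℕ), W.card ≤ M ∧ (∀ q ∈ W, F.ratio q.1 q.2 ≤ r) ∧
      ∀ ω, (F.point ω : EuclideanSpace ℝ (Fin d)) ∈ V → ∃ q ∈ W, ∀ i < q.2, ω i = q.1 i := by
  classical
  obtain ⟨a, c, hc, hsep⟩ := F.exists_separated_center
  obtain ⟨R, hR⟩ := F.selfSimilar.2.1.isBounded.subset_closedBall a
  have hδ : 0 < F.amin * c / 2 := by have := F.amin_pos; positivity
  obtain ⟨t, -, htf, htc⟩ := (isCompact_closedBall (0 : EuclideanSpace ℝ (Fin d))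
    (R + 1)).finite_cover_balls hδ
  refine ⟨htf.toFinset.card, fun r hr hr1 V hV => ?_⟩
  choose n hn1 hn2 hn3 using fun ω => F.exists_stopping ω hr hr1
  by_cases hV0 : ∃ ω, (F.point ω : EuclideanSpace ℝ (Fin d)) ∈ V
  swap
  · exact ⟨∅, by simp, by simp, fun ω hω => (hV0 ⟨ω, hω⟩).elim⟩
  obtain ⟨ω₀, hω₀⟩ := hV0
  let v₀ : EuclideanSpace ℝ (Fin d) := (F.point ω₀).1
  -- The rescaled centres of the pieces lie in a fixed ball, and those of distinct pieces are
  -- separated by `F.amin * c`.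
  let y : (ℕ → Fin p) → EuclideanSpace ℝ (Fin d) := fun ω => r⁻¹ • (F.comp ω (n ω) a - v₀)
  have hy : ∀ ω, (F.point ω : EuclideanSpace ℝ (Fin d)) ∈ V →
      y ω ∈ Metric.closedBall (0 : EuclideanSpace ℝ (Fin d)) (R + 1) := by
    intro ω hω
    obtain ⟨z, hz, hz'⟩ := F.point_mem ω (n ω)
    have hzR : ‖a - z‖ ≤ R := by
      have := hR hz
      rwa [mem_closedBall_iff_norm, norm_sub_rev] at this
    have h1 : ‖F.comp ω (n ω) a - F.point ω‖ ≤ r * R := by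
      rw [← hz', norm_comp_sub]
      exact mul_le_mul (hn1 ω) hzR (norm_nonneg _) hr.le
    have h2 : ‖F.comp ω (n ω) a - v₀‖ ≤ r * R + r :=
      (norm_sub_le_norm_sub_add_norm_sub _ (F.point ω : EuclideanSpace ℝ (Fin d)) _).trans
        (add_le_add h1 (hV _ hω _ hω₀))
    rw [mem_closedBall_zero_iff, norm_smul, norm_inv, Real.norm_of_nonneg hr.le,
      inv_mul_le_iff₀ hr]
    linarith
  let f : EuclideanSpace ℝ (Fin d) → (ℕ → Fin p) := fun b =>
    if h : ∃ ω, (F.point ω : EuclideanSpace ℝ (Fin d)) ∈ V ∧ y ω ∈ Metric.ball b (F.amin * c / 2)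
    then h.choose else ω₀
  refine ⟨htf.toFinset.image fun b => (f b, n (f b)), Finset.card_image_le, ?_, ?_⟩
  · intro q hq
    obtain ⟨b, -, rfl⟩ := Finset.mem_image.1 hq
    exact hn1 _
  intro ω hω
  obtain ⟨b, hb, hyb⟩ := mem_iUnion₂.1 (htc (hy ω hω))
  have hex : ∃ ω, (F.point ω : EuclideanSpace ℝ (Fin d)) ∈ V ∧
    y ω ∈ Metric.ball b (F.amin * c / 2) := ⟨ω, hω, hyb⟩
  have hfb : y (f b) ∈ Metric.ball b (F.amin * c / 2) := by
    simp only [f, dif_pos hex]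
    exact hex.choose_spec.2
  refine ⟨(f b, n (f b)), Finset.mem_image.2 ⟨b, htf.mem_toFinset.2 hb, rfl⟩, ?_⟩
  have hclose : ‖F.comp (f b) (n (f b)) a - F.comp ω (n ω) a‖ < r * F.amin * c := by
    have h1 : ‖y (f b) - y ω‖ < F.amin * c := by
      rw [← dist_eq_norm]
      have h2 := Metric.mem_ball.1 hfb
      have h3 := Metric.mem_ball'.1 hyb
      linarith [dist_triangle (y (f b)) b (y ω)]
    simp only [y, ← smul_sub, sub_sub_sub_cancel_right, norm_smul, norm_inv,
      Real.norm_of_nonneg hr.le] at h1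
    rw [inv_mul_lt_iff₀ hr] at h1
    linarith
  have hag : ∀ i, i < n ω → i < n (f b) → ω i = f b i := by
    intro i h1 h2
    by_contra hne
    have := hsep ω (f b) _ _ ⟨i, h1, h2, hne⟩
    have h3 := mul_le_mul_of_nonneg_right (hn2 ω) hc.le
    linarith
  rcases le_or_gt (n (f b)) (n ω) with h | h
  · exact fun i hi => hag i (lt_of_lt_of_le hi h) hi
  · have h1 := hn3 (f b) _ h
    rw [← F.ratio_congr fun i hi => hag i hi (hi.trans h)] at h1
    exact absurd (hn1 ω) (not_le.2 h1)

/-! ### Random codes with forced letters -/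

/-- The law of a letter: `i` has probability `α i ^ s`. -/
def letterLaw : PMF (Fin p) :=
  PMF.ofFintype (fun i => ENNReal.ofReal (F.α i ^ F.s)) (by
    rw [← ENNReal.ofReal_sum_of_nonneg fun i _ => Real.rpow_nonneg (F.α_pos i).le _, F.moran,
      ENNReal.ofReal_one])

/-- The Bernoulli measure on codes: the letters are independent with law `letterLaw`. -/
def bernoulli : Measure (ℕ → Fin p) := Measure.infinitePi fun _ => F.letterLaw.toMeasure

instance : IsProbabilityMeasure F.bernoulli := by unfold bernoulli; infer_instance

lemma letterLaw_singleton (i : Fin p) :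
    F.letterLaw.toMeasure {i} = ENNReal.ofReal (F.α i ^ F.s) := by
  rw [PMF.toMeasure_apply_singleton _ _ (measurableSet_singleton i)]
  rfl

/-- A rule which decides from the first `n` letters of a code whether its letter `n` is forced to
be the fixed letter. -/
structure ForcingRule (p : ℕ) where
  Forced : ℕ → (ℕ → Fin p) → Prop
  congr : ∀ n x y, (∀ i < n, x i = y i) → (Forced n x ↔ Forced n y)
  measurableSet : ∀ n, MeasurableSet {x | Forced n x}

variable {F}

open Classical in
/-- Auxiliary recursion for `force`: the first `n` letters have been treated. -/
def forceAux (F : SelfSimilarSystem d p) (G : ForcingRule p) (ω : ℕ → Fin p) : ℕ → ℕ → Fin p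
  | 0 => fun _ => F.letter
  | n + 1 => Function.update (forceAux F G ω n) n
      (if G.Forced n (forceAux F G ω n) then F.letter else ω n)

variable (F)

/-- The code obtained from `ω` by replacing the letters at forced places by the fixed letter. -/
def force (G : ForcingRule p) (ω : ℕ → Fin p) : ℕ → Fin p := fun n => forceAux F G ω (n + 1) n

lemma forceAux_eq_force (G : ForcingRule p) (ω : ℕ → Fin p) {n i : ℕ} (h : i < n) :
    forceAux F G ω n i = F.force G ω i := by
  induction n with
  | zero => omega
  | succ n ih =>
    rcases Nat.lt_succ_iff_lt_or_eq.1 h with h | rfl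
    · rw [forceAux, Function.update_of_ne h.ne, ih h]
    · rfl

open Classical in
lemma force_apply (G : ForcingRule p) (ω : ℕ → Fin p) (n : ℕ) :
    F.force G ω n = if G.Forced n (F.force G ω) then F.letter else ω n := by
  rw [force, forceAux, Function.update_self]
  congr 1
  exact propext (G.congr n _ _ fun i hi => F.forceAux_eq_force G ω hi)

lemma measurable_force (G : ForcingRule p) : Measurable (F.force G) := by
  classical
  have h : ∀ n, Measurable fun ω => forceAux F G ω n := by
    intro n
    induction n with
    | zero => exact measurable_const
    | succ n ih =>
      refine measurable_pi_lambda _ fun i => ?_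
      by_cases hi : i = n
      · subst hi
        simp only [forceAux, Function.update_self]
        exact Measurable.ite (ih (G.measurableSet i)) measurable_const (measurable_pi_apply i)
      · simp only [forceAux, Function.update_of_ne hi]
        exact (measurable_pi_apply i).comp ih
  exact measurable_pi_lambda _ fun n => (measurable_pi_apply n).comp (h (n + 1))

open Classical in
/-- An upper bound for the probability that a forced code starts with the first `n` letters
of `x`. -/
def cylBound (G : ForcingRule p) (x : ℕ → Fin p) (n : ℕ) : ℝ :=
  ∏ i ∈ Finset.range n, if G.Forced i x then 1 else F.α (x i) ^ F.s

lemma bernoulli_cylinder_le (G : ForcingRule p) (x : ℕ → Fin p) (n : ℕ) :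
    F.bernoulli {ω | ∀ i < n, F.force G ω i = x i} ≤ ENNReal.ofReal (F.cylBound G x n) := by
  classical
  -- At the free places the underlying independent letters have to agree with `x`.
  have h1 : {ω | ∀ i < n, F.force G ω i = x i} ⊆
      Set.pi (Finset.range n) fun i => if G.Forced i x then univ else {x i} := by
    intro ω hω i hi
    have hi' : i < n := by simpa using hi
    by_cases hf : G.Forced i x
    · simp [hf]
    · have h2 := F.force_apply G ω i
      rw [G.congr i _ x fun j hj => hω j (hj.trans hi'), if_neg hf, hω i hi'] at h2
      simp [hf, h2]
  refine (measure_mono h1).trans ?_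
  rw [bernoulli, Measure.infinitePi_pi _ fun i _ => by split_ifs <;> simp, cylBound,
    ENNReal.ofReal_prod_of_nonneg fun i _ => ?_]
  · refine Finset.prod_le_prod' fun i _ => ?_
    split_ifs with hf
    · simp
    · rw [letterLaw_singleton]
  · split_ifs
    · exact zero_le_one
    · exact Real.rpow_nonneg (F.α_pos _).le _

/-- If the cylinder probabilities decay like the power `h` of the ratio, the law of the coded point
gives mass at most a constant times `r ^ h` to sets of small diameter `r`. -/
lemma exists_bernoulli_le_rpow (G : ForcingRule p) {C h : ℝ} (h0 : 0 ≤ h) (hC : 0 ≤ C) (n₀ : ℕ)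
    (hG : ∀ x n, n₀ ≤ n → F.cylBound G x n ≤ C * F.ratio x n ^ h) :
    ∃ C' r₀ : ℝ, 0 < C' ∧ 0 < r₀ ∧ ∀ r, 0 < r → r < r₀ →
      ∀ V : Set (EuclideanSpace ℝ (Fin d)), (∀ x ∈ V, ∀ y ∈ V, ‖x - y‖ ≤ r) →
        F.bernoulli {ω | (F.point (F.force G ω) : EuclideanSpace ℝ (Fin d)) ∈ V} ≤
          ENNReal.ofReal (C' * r ^ h) := by
  obtain ⟨M, hM⟩ := F.exists_cylinder_cover
  refine ⟨M * C + 1, F.amin ^ n₀, by positivity, pow_pos F.amin_pos _, fun r hr hr0 V hV => ?_⟩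
  have hr1 : r < 1 := hr0.trans_le (pow_le_one₀ F.amin_pos.le F.amin_lt_one.le)
  obtain ⟨W, hWM, hWr, hW⟩ := hM r hr hr1 V hV
  have hsub : {ω | (F.point (F.force G ω) : EuclideanSpace ℝ (Fin d)) ∈ V} ⊆
      ⋃ q ∈ W, {ω | ∀ i < q.2, F.force G ω i = q.1 i} := by
    intro ω hω
    obtain ⟨q, hq, hq'⟩ := hW _ hω
    exact mem_iUnion₂.2 ⟨q, hq, hq'⟩
  have hrh : 0 ≤ r ^ h := Real.rpow_nonneg hr.le _
  calc F.bernoulli {ω | (F.point (F.force G ω) : EuclideanSpace ℝ (Fin d)) ∈ V}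
      ≤ ∑ q ∈ W, F.bernoulli {ω | ∀ i < q.2, F.force G ω i = q.1 i} :=
        (measure_mono hsub).trans (measure_biUnion_finset_le _ _)
    _ ≤ ∑ q ∈ W, ENNReal.ofReal (C * r ^ h) := by
        refine Finset.sum_le_sum fun q hq => (F.bernoulli_cylinder_le G _ _).trans ?_
        refine ENNReal.ofReal_le_ofReal ((hG _ _ ?_).trans ?_)
        · by_contra! hlt
          have h1 := (F.pow_le_ratio q.1 q.2).trans (hWr q hq)
          have h2 := pow_le_pow_of_le_one F.amin_pos.le F.amin_lt_one.le hlt.le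
          linarith
        · exact mul_le_mul_of_nonneg_left
            (Real.rpow_le_rpow (F.ratio_pos _ _).le (hWr q hq) h0) hC
    _ = ENNReal.ofReal (W.card * (C * r ^ h)) := by
        rw [Finset.sum_const, nsmul_eq_mul, ENNReal.ofReal_mul (Nat.cast_nonneg _),
          ENNReal.ofReal_natCast]
    _ ≤ ENNReal.ofReal ((M * C + 1) * r ^ h) := by
        refine ENNReal.ofReal_le_ofReal ?_
        have : (W.card : ℝ) * (C * r ^ h) ≤ M * (C * r ^ h) :=
          mul_le_mul_of_nonneg_right (by exact_mod_cast hWM) (by positivity)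
        nlinarith

/-- Under the same decay of cylinder probabilities, the coded point almost surely avoids every set
of dimension less than `h`. -/
lemma bernoulli_eq_zero_of_dimH_lt (G : ForcingRule p) {C h : ℝ} (hh : 0 < h) (hC : 0 ≤ C)
    (n₀ : ℕ) (hG : ∀ x n, n₀ ≤ n → F.cylBound G x n ≤ C * F.ratio x n ^ h)
    {A : Set (EuclideanSpace ℝ (Fin d))} (hA : dimH A < ENNReal.ofReal h) :
    F.bernoulli {ω | (F.point (F.force G ω) : EuclideanSpace ℝ (Fin d)) ∈ A} = 0 := by
  obtain ⟨C', r₀, hC', hr₀, hb⟩ := F.exists_bernoulli_le_rpow G hh.le hC n₀ hG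
  set f : (ℕ → Fin p) → EuclideanSpace ℝ (Fin d) := fun ω => F.point (F.force G ω) with hf
  have hfm : Measurable f :=
    (measurable_subtype_coe.comp F.continuous_point.measurable).comp (F.measurable_force G)
  set m : Measure (EuclideanSpace ℝ (Fin d)) := ENNReal.ofReal C'⁻¹ • F.bernoulli.map f with hm
  have hC0 : ENNReal.ofReal C'⁻¹ ≠ 0 := by simpa using hC'
  have key : m ≤ μH[h] := by
    refine Measure.le_hausdorffMeasure h m (ENNReal.ofReal (r₀ / 2)) (by simpa using hr₀) ?_
    intro V hV
    have hfin : Metric.ediam V ≠ ∞ := ne_top_of_le_ne_top ENNReal.ofReal_ne_top hV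
    set δ := (Metric.ediam V).toReal with hδ
    have hδe : Metric.ediam V = ENNReal.ofReal δ := (ENNReal.ofReal_toReal hfin).symm
    have hδ0 : 0 ≤ δ := ENNReal.toReal_nonneg
    have hδr : δ ≤ r₀ / 2 := by
      rw [hδe] at hV
      exact (ENNReal.ofReal_le_ofReal_iff (by positivity)).1 hV
    -- Passing to the closure makes `V` measurable and keeps its diameter; the power bound needs a
    -- positive radius, hence the limit `r → δ`, which also covers the case of diameter zero.
    have hVc : ∀ x ∈ closure V, ∀ y ∈ closure V, ‖x - y‖ ≤ δ := by
      intro x hx y hy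
      have := Metric.edist_le_ediam_of_mem hx hy
      rw [Metric.ediam_closure, hδe, edist_dist, ENNReal.ofReal_le_ofReal_iff hδ0] at this
      rwa [← dist_eq_norm]
    have h1 : ∀ r, δ < r → r < r₀ →
        F.bernoulli.map f (closure V) ≤ ENNReal.ofReal (C' * r ^ h) := by
      intro r h1 h2
      rw [Measure.map_apply hfm isClosed_closure.measurableSet]
      exact hb r (hδ0.trans_lt h1) h2 _ fun x hx y hy => (hVc x hx y hy).trans h1.le
    have h2 : F.bernoulli.map f (closure V) ≤ ENNReal.ofReal (C' * δ ^ h) := by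
      have hcont : Tendsto (fun r : ℝ => ENNReal.ofReal (C' * r ^ h)) (𝓝[>] δ)
          (𝓝 (ENNReal.ofReal (C' * δ ^ h))) :=
        (ENNReal.continuous_ofReal.continuousAt.tendsto.comp
          (((Real.continuous_rpow_const hh.le).const_mul C').tendsto δ)).mono_left
          nhdsWithin_le_nhds
      refine ge_of_tendsto hcont ?_
      filter_upwards [Ioo_mem_nhdsGT (show δ < r₀ by linarith)] with r hr
      exact h1 r hr.1 hr.2
    calc m V ≤ m (closure V) := measure_mono subset_closure
      _ ≤ ENNReal.ofReal C'⁻¹ * ENNReal.ofReal (C' * δ ^ h) := by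
          rw [hm, Measure.smul_apply, smul_eq_mul]
          exact mul_le_mul_right h2 _
      _ = ENNReal.ofReal (δ ^ h) := by
          rw [← ENNReal.ofReal_mul (by positivity), inv_mul_cancel_left₀ hC'.ne']
      _ = Metric.ediam V ^ h := by rw [hδe, ENNReal.ofReal_rpow_of_nonneg hδ0 hh.le]
  have h1 : μH[h] A = 0 := by
    have := hausdorffMeasure_of_dimH_lt (s := A) (d := h.toNNReal) hA
    rwa [Real.coe_toNNReal _ hh.le] at this
  have h2 : m A = 0 := le_antisymm ((key A).trans h1.le) zero_le
  rw [hm, Measure.smul_apply, smul_eq_mul, mul_eq_zero, or_iff_right hC0] at h2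
  exact Measure.preimage_null_of_map_null hfm.aemeasurable h2

end SelfSimilarSystem

/-! ### The natural measure and the dimension of the self-similar set -/

/-- Contraction ratios admit a similarity dimension. -/
lemma exists_sum_rpow_eq_one {p : ℕ} [Nonempty (Fin p)] {α : Fin p → ℝ} (h0 : ∀ i, 0 < α i)
    (h1 : ∀ i, α i < 1) : ∃ s : ℝ, 0 ≤ s ∧ ∑ i, α i ^ s = 1 := by
  have hcont : Continuous fun s : ℝ => ∑ i, α i ^ s :=
    continuous_finsetSum _ fun i _ => Real.continuous_const_rpow (h0 i).ne'
  have hlim : Tendsto (fun s : ℝ => ∑ i, α i ^ s) atTop (𝓝 0) := by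
    rw [← Finset.sum_const_zero (s := (Finset.univ : Finset (Fin p)))]
    exact tendsto_finsetSum _ fun i _ =>
      tendsto_rpow_atTop_of_base_lt_one _ (by linarith [h0 i]) (h1 i)
  obtain ⟨b, hb, hb'⟩ := ((hlim.eventually (gt_mem_nhds one_pos)).and
    (eventually_ge_atTop (0 : ℝ))).exists
  have hz : (1 : ℝ) ≤ ∑ i, α i ^ (0 : ℝ) := by
    have : 0 < p := Fin.pos_iff_nonempty.2 inferInstance
    simpa using (by exact_mod_cast this : (1 : ℝ) ≤ p)
  obtain ⟨s, hs, hs'⟩ := intermediate_value_Icc' hb' hcont.continuousOn ⟨hb.le, hz⟩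
  exact ⟨s, hs.1, hs'⟩

namespace SelfSimilarSystem

variable {d p : ℕ} (F : SelfSimilarSystem d p)

lemma rpow_ratio (ω : ℕ → Fin p) (n : ℕ) (t : ℝ) :
    F.ratio ω n ^ t = ∏ i ∈ Finset.range n, F.α (ω i) ^ t :=
  (Real.finsetProd_rpow _ _ (fun _ _ => (F.α_pos _).le) _).symm

/-- The rule that forces no letter. -/
def ForcingRule.none (p : ℕ) : ForcingRule p where
  Forced _ _ := False
  congr _ _ _ _ := Iff.rfl
  measurableSet _ := by simp

@[simp] lemma force_none (ω : ℕ → Fin p) : F.force (ForcingRule.none p) ω = ω := by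
  refine funext fun n => (F.force_apply _ ω n).trans (if_neg fun h => h)

lemma cylBound_none (x : ℕ → Fin p) (n : ℕ) :
    F.cylBound (ForcingRule.none p) x n = F.ratio x n ^ F.s := by
  rw [rpow_ratio]
  exact Finset.prod_congr rfl fun i _ => if_neg fun h => h

lemma bernoulli_cylinder (x : ℕ → Fin p) (n : ℕ) :
    F.bernoulli {ω | ∀ i < n, ω i = x i} = ENNReal.ofReal (F.ratio x n ^ F.s) := by
  have : {ω : ℕ → Fin p | ∀ i < n, ω i = x i} = Set.pi (Finset.range n) fun i => {x i} := by
    ext ω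
    simp
  rw [this, bernoulli, Measure.infinitePi_pi _ fun i _ => measurableSet_singleton _, rpow_ratio,
    ENNReal.ofReal_prod_of_nonneg fun i _ => Real.rpow_nonneg (F.α_pos _).le _]
  exact Finset.prod_congr rfl fun i _ => F.letterLaw_singleton _

/-- The natural self-similar measure on `K`. -/
def natural : ProbabilityMeasure F.K :=
  ⟨F.bernoulli.map F.point,
    Measure.isProbabilityMeasure_map F.continuous_point.measurable.aemeasurable⟩

lemma exists_natural_le : ∃ C r₀ : ℝ, 0 < C ∧ 0 < r₀ ∧ ∀ r, 0 < r → r < r₀ →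
    ∀ V : Set (EuclideanSpace ℝ (Fin d)), MeasurableSet V → (∀ x ∈ V, ∀ y ∈ V, ‖x - y‖ ≤ r) →
      (F.natural : Measure F.K) {y | (y : EuclideanSpace ℝ (Fin d)) ∈ V} ≤
        ENNReal.ofReal (C * r ^ F.s) := by
  obtain ⟨C, r₀, hC, hr₀, h⟩ := F.exists_bernoulli_le_rpow (ForcingRule.none p) F.s_nonneg
    zero_le_one 0 fun x n _ => by rw [cylBound_none, one_mul]
  refine ⟨C, r₀, hC, hr₀, fun r hr hr' V hVm hV => ?_⟩
  refine le_trans (le_of_eq ?_) (h r hr hr' V hV)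
  change F.bernoulli.map F.point _ = _
  have hm : MeasurableSet {y : F.K | (y : EuclideanSpace ℝ (Fin d)) ∈ V} :=
    measurable_subtype_coe hVm
  rw [Measure.map_apply F.continuous_point.measurable hm]
  simp

lemma exists_le_natural_ball : ∃ c : ℝ, 0 < c ∧ ∀ r, 0 < r → r < 1 → ∀ x : F.K,
    ENNReal.ofReal (c * r ^ F.s) ≤ (F.natural : Measure F.K)
      {y | ‖(y : EuclideanSpace ℝ (Fin d)) - x‖ < r} := by
  have hD := F.one_le_size
  have ha := F.amin_pos
  refine ⟨(F.amin / (2 * F.size)) ^ F.s, by positivity, fun r hr hr1 x => ?_⟩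
  obtain ⟨ω, rfl⟩ := F.point_surjective x
  obtain ⟨n, hn1, hn2, -⟩ := F.exists_stopping ω (r := r / (2 * F.size)) (by positivity)
    (by rw [div_lt_one (by positivity)]; linarith)
  have hopen : IsOpen {y : F.K | ‖(y : EuclideanSpace ℝ (Fin d)) - F.point ω‖ < r} :=
    isOpen_lt (by fun_prop) continuous_const
  change _ ≤ F.bernoulli.map F.point _
  rw [Measure.map_apply F.continuous_point.measurable hopen.measurableSet]
  calc ENNReal.ofReal ((F.amin / (2 * F.size)) ^ F.s * r ^ F.s)
      ≤ ENNReal.ofReal (F.ratio ω n ^ F.s) := by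
        refine ENNReal.ofReal_le_ofReal ?_
        rw [← Real.mul_rpow (by positivity) hr.le]
        refine Real.rpow_le_rpow (by positivity) (le_trans (le_of_eq (by ring)) hn2) F.s_nonneg
    _ = F.bernoulli {ω' | ∀ i < n, ω' i = ω i} := (F.bernoulli_cylinder ω n).symm
    _ ≤ _ := by
        refine measure_mono fun ω' hω' => ?_
        have h1 := F.norm_point_sub_le (n := n) fun i hi => (hω' i hi).symm
        rw [norm_sub_rev] at h1
        refine lt_of_le_of_lt h1 ?_
        calc F.size * F.ratio ω n ≤ F.size * (r / (2 * F.size)) :=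
              mul_le_mul_of_nonneg_left hn1 F.size_pos.le
          _ = r / 2 := by field_simp
          _ < r := half_lt_self hr

/-- A finite word, extended by the fixed letter. -/
def extend {n : ℕ} (w : Fin n → Fin p) : ℕ → Fin p :=
  fun i => if h : i < n then w ⟨i, h⟩ else F.letter

lemma extend_apply {n : ℕ} (ω : ℕ → Fin p) {i : ℕ} (h : i < n) :
    F.extend (fun j : Fin n => ω j) i = ω i := by
  simp [extend, h]

lemma ratio_extend {n : ℕ} (w : Fin n → Fin p) : F.ratio (F.extend w) n = ∏ i, F.α (w i) := by
  rw [ratio, Finset.prod_range]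
  exact Finset.prod_congr rfl fun i _ => by simp [extend]

lemma sum_ratio_rpow (n : ℕ) : ∑ w : Fin n → Fin p, F.ratio (F.extend w) n ^ F.s = 1 := by
  have h : ∀ w : Fin n → Fin p, F.ratio (F.extend w) n ^ F.s = ∏ i, F.α (w i) ^ F.s := fun w => by
    rw [ratio_extend, Real.finsetProd_rpow _ _ (fun _ _ => (F.α_pos _).le)]
  simp_rw [h]
  rw [← Fintype.sum_pow (fun i => F.α i ^ F.s) n, F.moran, one_pow]

lemma subset_iUnion_comp (n : ℕ) :
    F.K ⊆ ⋃ w : Fin n → Fin p, F.comp (F.extend w) n '' F.K := by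
  intro x hx
  obtain ⟨ω, hω⟩ := F.point_surjective ⟨x, hx⟩
  refine mem_iUnion.2 ⟨fun j => ω j, ?_⟩
  rw [F.comp_congr fun i hi => F.extend_apply ω hi]
  have := F.point_mem ω n
  rwa [hω] at this

/-- The pieces coded by the words of length `n` cover `K`, and the sum of the powers `s` of their
diameters is bounded. -/
lemma dimH_le : dimH F.K ≤ ENNReal.ofReal F.s := by
  have hdiam : ∀ (n : ℕ) (w : Fin n → Fin p), Metric.ediam (F.comp (F.extend w) n '' F.K) ≤
      ENNReal.ofReal (F.size * F.ratio (F.extend w) n) := by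
    intro n w
    refine Metric.ediam_le fun x hx y hy => ?_
    rw [edist_dist, dist_eq_norm]
    exact ENNReal.ofReal_le_ofReal (F.norm_sub_le_of_mem_comp hx hy)
  have hlim : Tendsto (fun n : ℕ => ENNReal.ofReal (F.size * F.amax ^ n)) atTop (𝓝 0) := by
    have := ENNReal.tendsto_ofReal (F.tendsto_amax_pow.const_mul F.size)
    simpa using this
  have h1 := Measure.hausdorffMeasure_le_liminf_sum F.s F.K
    (fun n : ℕ => ENNReal.ofReal (F.size * F.amax ^ n)) hlim
    (fun n (w : Fin n → Fin p) => F.comp (F.extend w) n '' F.K)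
    (Eventually.of_forall fun n w => (hdiam n w).trans (ENNReal.ofReal_le_ofReal
      (mul_le_mul_of_nonneg_left (F.ratio_le_pow _ _) F.size_pos.le)))
    (Eventually.of_forall fun n => F.subset_iUnion_comp n)
  have h2 : ∀ n : ℕ, ∑ w : Fin n → Fin p, Metric.ediam (F.comp (F.extend w) n '' F.K) ^ F.s ≤
      ENNReal.ofReal (F.size ^ F.s) := by
    intro n
    calc ∑ w : Fin n → Fin p, Metric.ediam (F.comp (F.extend w) n '' F.K) ^ F.s
        ≤ ∑ w : Fin n → Fin p, ENNReal.ofReal (F.size ^ F.s * F.ratio (F.extend w) n ^ F.s) := by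
          refine Finset.sum_le_sum fun w _ => ?_
          refine (ENNReal.rpow_le_rpow (hdiam n w) F.s_nonneg).trans (le_of_eq ?_)
          have := F.size_pos
          have := F.ratio_pos (F.extend w) n
          rw [ENNReal.ofReal_rpow_of_nonneg (by positivity) F.s_nonneg,
            Real.mul_rpow (by positivity) (by positivity)]
      _ = ENNReal.ofReal (F.size ^ F.s) := by
          rw [← ENNReal.ofReal_sum_of_nonneg, ← Finset.mul_sum, sum_ratio_rpow, mul_one]
          intro w _
          have := F.size_pos
          have := F.ratio_pos (F.extend w) n
          positivity
  have h3 : μH[F.s] F.K ≠ ∞ := by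
    refine ne_top_of_le_ne_top (ENNReal.ofReal_ne_top (r := F.size ^ F.s)) (h1.trans ?_)
    refine (liminf_le_liminf (Eventually.of_forall h2)).trans ?_
    simp
  have := dimH_le_of_hausdorffMeasure_ne_top (d := F.s.toNNReal) (s := F.K)
    (by rwa [Real.coe_toNNReal _ F.s_nonneg])
  exact this

/-- A point with a Bernoulli code almost surely avoids sets of dimension less than `s`, but lies
in `K`. -/
lemma dimH_eq : dimH F.K = ENNReal.ofReal F.s := by
  refine le_antisymm F.dimH_le ?_
  by_contra! hlt
  have hs : 0 < F.s := by
    by_contra! h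
    simp [ENNReal.ofReal_of_nonpos h] at hlt
  have h1 := F.bernoulli_eq_zero_of_dimH_lt (ForcingRule.none p) hs
    zero_le_one 0 (fun x n _ => by rw [cylBound_none, one_mul]) hlt
  simp at h1

end SelfSimilarSystem

/-! ### Exponents as comparisons with powers -/

lemma log_div_log_le {r : ℝ} (h0 : 0 < r) (h1 : r < 1) {t : ℝ} {x : ℝ≥0∞}
    (h : ENNReal.ofReal (r ^ t) ≤ x) :
    ENNReal.log x / ((Real.log r : ℝ) : EReal) ≤ (t : EReal) := by
  have hl : Real.log r < 0 := Real.log_neg h0 h1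
  have h2 := EReal.div_le_div_right_of_nonpos (c := ((Real.log r : ℝ) : EReal))
    (by exact_mod_cast hl.le) (ENNReal.log_le_log h)
  refine h2.trans (le_of_eq ?_)
  rw [ENNReal.log_ofReal_of_pos (Real.rpow_pos_of_pos h0 t), Real.log_rpow h0, ← EReal.coe_div,
    mul_div_cancel_right₀ _ hl.ne]

lemma le_log_div_log {r : ℝ} (h0 : 0 < r) (h1 : r < 1) {t : ℝ} {x : ℝ≥0∞}
    (h : x ≤ ENNReal.ofReal (r ^ t)) :
    (t : EReal) ≤ ENNReal.log x / ((Real.log r : ℝ) : EReal) := by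
  have hl : Real.log r < 0 := Real.log_neg h0 h1
  have h2 := EReal.div_le_div_right_of_nonpos (c := ((Real.log r : ℝ) : EReal))
    (by exact_mod_cast hl.le) (ENNReal.log_le_log h)
  refine (le_of_eq ?_).trans h2
  rw [ENNReal.log_ofReal_of_pos (Real.rpow_pos_of_pos h0 t), Real.log_rpow h0, ← EReal.coe_div,
    mul_div_cancel_right₀ _ hl.ne]

lemma eventually_lt_one_nhdsGT : ∀ᶠ r : ℝ in 𝓝[>] 0, 0 < r ∧ r < 1 := by
  filter_upwards [Ioo_mem_nhdsGT (zero_lt_one' ℝ)] with r hr using hr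

lemma eventually_mul_rpow_le_one (C : ℝ) {ε : ℝ} (hε : 0 < ε) :
    ∀ᶠ r : ℝ in 𝓝[>] 0, C * r ^ ε ≤ 1 := by
  have h : Tendsto (fun r : ℝ => C * r ^ ε) (𝓝[>] 0) (𝓝 (C * 0 ^ ε)) :=
    (((Real.continuous_rpow_const hε.le).const_mul C).tendsto 0).mono_left nhdsWithin_le_nhds
  rw [Real.zero_rpow hε.ne', mul_zero] at h
  exact (h.eventually (gt_mem_nhds one_pos)).mono fun _ h => h.le

lemma EReal.le_of_forall_pos_le_add_coe {a : EReal} {b : ℝ}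
    (h : ∀ ε : ℝ, 0 < ε → a ≤ ((b + ε : ℝ) : EReal)) : a ≤ b := by
  refine EReal.le_of_forall_lt_iff_le.1 fun z hz => ?_
  have hz' : b < z := by exact_mod_cast hz
  have h1 : 0 < z - b := by linarith
  simpa using h (z - b) h1

lemma EReal.ge_of_forall_pos_sub_coe_le {a : EReal} {b : ℝ}
    (h : ∀ ε : ℝ, 0 < ε → ((b - ε : ℝ) : EReal) ≤ a) : (b : EReal) ≤ a := by
  refine EReal.ge_of_forall_gt_iff_ge.1 fun z hz => ?_
  have hz' : z < b := by exact_mod_cast hz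
  have h1 : 0 < b - z := by linarith
  simpa using h (b - z) h1

section Seminorm

variable {d : ℕ} (N : Seminorm ℝ (EuclideanSpace ℝ (Fin d)))

lemma seminorm_continuous : Continuous N :=
  continuousOn_univ.1 (N.convexOn.continuousOn isOpen_univ)

lemma exists_seminorm_le : ∃ C : ℝ, 0 < C ∧ ∀ x, N x ≤ C * ‖x‖ :=
  N.bound_of_continuous_normedSpace (seminorm_continuous N)

lemma exists_le_seminorm (hN : ∀ x, N x = 0 → x = 0) : ∃ c : ℝ, 0 < c ∧ ∀ x, c * ‖x‖ ≤ N x := by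
  rcases (Metric.sphere (0 : EuclideanSpace ℝ (Fin d)) 1).eq_empty_or_nonempty with h | h
  · refine ⟨1, one_pos, fun x => ?_⟩
    by_cases hx : x = 0
    · simp [hx]
    · have : ‖x‖⁻¹ • x ∈ Metric.sphere (0 : EuclideanSpace ℝ (Fin d)) 1 := by
        rw [mem_sphere_zero_iff_norm, norm_smul, norm_inv, norm_norm,
          inv_mul_cancel₀ (norm_ne_zero_iff.2 hx)]
      simp [h] at this
  · obtain ⟨u, hu, hmin⟩ := (isCompact_sphere _ _).exists_isMinOn h
      (seminorm_continuous N).continuousOn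
    have hu0 : N u ≠ 0 := fun h0 => by
      rw [hN u h0] at hu
      simp at hu
    refine ⟨N u, (apply_nonneg N u).lt_of_ne' hu0, fun x => ?_⟩
    by_cases hx : x = 0
    · simp [hx]
    have hx' : 0 < ‖x‖ := norm_pos_iff.2 hx
    have hm : ‖x‖⁻¹ • x ∈ Metric.sphere (0 : EuclideanSpace ℝ (Fin d)) 1 := by
      rw [mem_sphere_zero_iff_norm, norm_smul, norm_inv, norm_norm, inv_mul_cancel₀ hx'.ne']
    have := isMinOn_iff.1 hmin _ hm
    rw [map_smul_eq_mul, norm_inv, norm_norm, le_inv_mul_iff₀ hx'] at this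
    linarith

variable {K : Set (EuclideanSpace ℝ (Fin d))} (μ : ProbabilityMeasure K) (x : K)

lemma localHolderExponent_nonneg : 0 ≤ localHolderExponent N μ x := by
  refine le_liminf_of_le (by isBoundedDefault) ?_
  filter_upwards [eventually_lt_one_nhdsGT] with r hr
  have := le_log_div_log hr.1 hr.2 (t := 0)
    (x := (μ : Measure K) {y : K | N ((y : EuclideanSpace ℝ (Fin d)) - x) < r})
    (by simpa using prob_le_one)
  exact_mod_cast this

variable {N μ x}

/-- The local exponent is at most `t` as soon as balls of the Euclidean norm around `x` have
mass at least `ρ ^ (t + ε)` at arbitrarily small scales `ρ`. -/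
lemma localHolderExponent_le {C t : ℝ} (hC : 0 < C)
    (h : ∀ ε : ℝ, 0 < ε → ∃ᶠ ρ in 𝓝[>] (0 : ℝ), ENNReal.ofReal (ρ ^ (t + ε)) ≤
      (μ : Measure K) {y : K | ‖(y : EuclideanSpace ℝ (Fin d)) - x‖ < C * ρ}) :
    localHolderExponent N μ x ≤ (t : EReal) := by
  obtain ⟨D, hD, hND⟩ := exists_seminorm_le N
  refine EReal.le_of_forall_pos_le_add_coe fun ε hε => ?_
  refine liminf_le_of_frequently_le ?_ (by isBoundedDefault)
  have hDC : 0 < D * C := by positivity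
  have htend : Tendsto (fun ρ : ℝ => D * C * ρ) (𝓝[>] 0) (𝓝[>] 0) := by
    refine tendsto_nhdsWithin_iff.2 ⟨?_, ?_⟩
    · have : Tendsto (fun ρ : ℝ => D * C * ρ) (𝓝 0) (𝓝 (D * C * 0)) :=
        (continuous_const_mul (D * C)).tendsto 0
      rw [mul_zero] at this
      exact this.mono_left nhdsWithin_le_nhds
    · filter_upwards [self_mem_nhdsWithin] with ρ hρ
      exact mul_pos hDC hρ
  refine htend.frequently ?_
  refine ((h (ε / 2) (half_pos hε)).and_eventually (((eventually_mul_rpow_le_one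
    ((D * C) ^ (t + ε)) (half_pos hε)).and eventually_lt_one_nhdsGT).and
      (htend.eventually eventually_lt_one_nhdsGT))).mono ?_
  rintro ρ ⟨hρ, ⟨hρ1, hρ2⟩, hρ3⟩
  refine log_div_log_le hρ3.1 hρ3.2 ?_
  refine (ENNReal.ofReal_le_ofReal ?_).trans (hρ.trans (measure_mono fun y hy => ?_))
  · have h0 : 0 < ρ := hρ2.1
    calc (D * C * ρ) ^ (t + ε) = (D * C) ^ (t + ε) * ρ ^ (ε / 2) * ρ ^ (t + ε / 2) := by
          rw [Real.mul_rpow hDC.le h0.le, mul_assoc, ← Real.rpow_add h0]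
          ring_nf
      _ ≤ 1 * ρ ^ (t + ε / 2) := mul_le_mul_of_nonneg_right hρ1 (by positivity)
      _ = _ := one_mul _
  · calc N ((y : EuclideanSpace ℝ (Fin d)) - x) ≤ D * ‖(y : EuclideanSpace ℝ (Fin d)) - x‖ := hND _
      _ < D * (C * ρ) := mul_lt_mul_of_pos_left hy hD
      _ = D * C * ρ := (mul_assoc _ _ _).symm

lemma frequently_of_localHolderExponent_lt {t : ℝ}
    (h : localHolderExponent N μ x < (t : EReal)) :
    ∃ᶠ r in 𝓝[>] (0 : ℝ), ENNReal.ofReal (r ^ t) ≤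
      (μ : Measure K) {y : K | N ((y : EuclideanSpace ℝ (Fin d)) - x) < r} := by
  refine ((frequently_lt_of_liminf_lt (by isBoundedDefault) h).and_eventually
    eventually_lt_one_nhdsGT).mono ?_
  rintro r ⟨hr, h0, h1⟩
  by_contra! hlt
  exact hr.not_ge (le_log_div_log h0 h1 hlt.le)

end Seminorm

/-! ### Dyadic cubes -/

/-- The side length of the dyadic cubes of generation `j`. -/
def mesh (j : ℕ) : ℝ := ((2 : ℝ) ^ j)⁻¹

lemma mesh_pos (j : ℕ) : 0 < mesh j := by unfold mesh; positivity

lemma mesh_lt_one {j : ℕ} (hj : j ≠ 0) : mesh j < 1 :=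
  inv_lt_one_of_one_lt₀ (one_lt_pow₀ one_lt_two hj)

lemma mesh_eq (j : ℕ) : mesh j = (1 / 2 : ℝ) ^ j := by simp [mesh]

lemma tendsto_mesh : Tendsto mesh atTop (𝓝 0) := by
  simp_rw [funext mesh_eq]
  exact tendsto_pow_atTop_nhds_zero_of_lt_one (by norm_num) (by norm_num)

lemma mesh_rpow (j : ℕ) (t : ℝ) : mesh j ^ t = ((1 / 2 : ℝ) ^ t) ^ j := by
  rw [mesh_eq, ← Real.rpow_natCast, ← Real.rpow_natCast, ← Real.rpow_mul (by norm_num),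
    ← Real.rpow_mul (by norm_num), mul_comm]

lemma eventually_mul_mesh_rpow_le_one (C : ℝ) {ε : ℝ} (hε : 0 < ε) :
    ∀ᶠ j : ℕ in atTop, C * (j + 1) * mesh j ^ ε ≤ 1 := by
  have hb : (1 / 2 : ℝ) ^ ε < 1 := Real.rpow_lt_one (by norm_num) (by norm_num) hε
  have hb0 : 0 ≤ (1 / 2 : ℝ) ^ ε := by positivity
  have h1 := tendsto_self_mul_const_pow_of_lt_one hb0 hb
  have h2 := tendsto_pow_atTop_nhds_zero_of_lt_one hb0 hb
  have h3 := (h1.add h2).const_mul C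
  rw [add_zero, mul_zero] at h3
  filter_upwards [h3.eventually (gt_mem_nhds one_pos)] with j hj
  rw [mesh_rpow]
  linarith

section Spectrum

variable {d : ℕ} {K : Set (EuclideanSpace ℝ (Fin d))} {μ : ProbabilityMeasure K}

lemma lqSpectrum_eq (q : ℝ) : lqSpectrum μ q =
    liminf (fun j : ℕ => ENNReal.log (partitionSum μ q j) / ((Real.log (mesh j) : ℝ) : EReal))
      atTop := by
  refine congrArg (fun f => liminf f atTop) (funext fun j => ?_)
  have : Real.log (mesh j) = -(j * Real.log 2) := by
    rw [mesh, Real.log_inv, Real.log_pow]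
  rw [this, EReal.coe_neg, EReal.div_eq_inv_mul, EReal.div_eq_inv_mul, EReal.inv_neg, mul_neg,
    neg_mul]

lemma lqSpectrum_le {q t : ℝ} (h : ∀ ε : ℝ, 0 < ε → ∃ᶠ j in atTop,
    ENNReal.ofReal (mesh j ^ (t + ε)) ≤ partitionSum μ q j) : lqSpectrum μ q ≤ (t : EReal) := by
  rw [lqSpectrum_eq]
  refine EReal.le_of_forall_pos_le_add_coe fun ε hε => ?_
  refine liminf_le_of_frequently_le ?_ (by isBoundedDefault)
  refine ((h ε hε).and_eventually (eventually_ne_atTop 0)).mono ?_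
  rintro j ⟨hj, hj0⟩
  exact log_div_log_le (mesh_pos j) (mesh_lt_one hj0) hj

lemma le_lqSpectrum {q t : ℝ} (h : ∀ ε : ℝ, 0 < ε → ∀ᶠ j in atTop,
    partitionSum μ q j ≤ ENNReal.ofReal (mesh j ^ (t - ε))) : (t : EReal) ≤ lqSpectrum μ q := by
  rw [lqSpectrum_eq]
  refine EReal.ge_of_forall_pos_sub_coe_le fun ε hε => ?_
  refine le_liminf_of_le (by isBoundedDefault) ?_
  filter_upwards [h ε hε, eventually_ne_atTop 0] with j hj hj0
  exact le_log_div_log (mesh_pos j) (mesh_lt_one hj0) hj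

/-- The index of the dyadic cube of generation `j` containing `x`. -/
def cubeIndex (j : ℕ) (x : EuclideanSpace ℝ (Fin d)) : Fin d → ℤ := fun i => ⌊x i * 2 ^ j⌋

lemma mem_dyadicCube_iff {j : ℕ} {k : Fin d → ℤ} {x : EuclideanSpace ℝ (Fin d)} :
    x ∈ dyadicCube j k ↔ cubeIndex j x = k := by
  have h2 : (0 : ℝ) < 2 ^ j := by positivity
  rw [funext_iff]
  refine forall_congr' fun i => ?_
  rw [cubeIndex, Int.floor_eq_iff, mul_inv_le_iff₀ h2, lt_mul_inv_iff₀ h2]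

lemma measurableSet_dyadicCube (j : ℕ) (k : Fin d → ℤ) :
    MeasurableSet (dyadicCube j k : Set (EuclideanSpace ℝ (Fin d))) := by
  have : (dyadicCube j k : Set (EuclideanSpace ℝ (Fin d))) = ⋂ i,
      {x | (k i : ℝ) * ((2 : ℝ) ^ j)⁻¹ ≤ x i} ∩ {x | x i < ((k i : ℝ) + 1) * ((2 : ℝ) ^ j)⁻¹} := by
    ext x; simp [dyadicCube]
  rw [this]
  refine MeasurableSet.iInter fun i => MeasurableSet.inter ?_ ?_
  · exact (isClosed_le continuous_const (by fun_prop)).measurableSet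
  · exact (isOpen_lt (by fun_prop) continuous_const).measurableSet

/-- The open cube with three times the side length of the dyadic cube of generation `j` and
index `k`, and the same centre. -/
def fatCube (j : ℕ) (k : Fin d → ℤ) : Set (EuclideanSpace ℝ (Fin d)) :=
  {x | ∀ i, ((k i : ℝ) - 1) * mesh j < x i ∧ x i < ((k i : ℝ) + 2) * mesh j}

lemma isOpen_fatCube (j : ℕ) (k : Fin d → ℤ) :
    IsOpen (fatCube j k : Set (EuclideanSpace ℝ (Fin d))) := by
  have : (fatCube j k : Set (EuclideanSpace ℝ (Fin d))) = ⋂ i,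
      {x | ((k i : ℝ) - 1) * mesh j < x i} ∩ {x | x i < ((k i : ℝ) + 2) * mesh j} := by
    ext x; simp [fatCube]
  rw [this]
  exact isOpen_iInter_of_finite fun i =>
    (isOpen_lt continuous_const (by fun_prop)).inter (isOpen_lt (by fun_prop) continuous_const)

lemma mem_fatCube_of_norm_sub_le {j : ℕ} {k : Fin d → ℤ} {x y : EuclideanSpace ℝ (Fin d)}
    (hx : x ∈ dyadicCube j k) (hy : ‖y - x‖ < mesh j) : y ∈ fatCube j k := by
  intro i
  have h1 := hx i
  have h2 : |y i - x i| < mesh j := (PiLp.norm_apply_le (y - x) i).trans_lt hy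
  rw [abs_lt] at h2
  change (k i : ℝ) * mesh j ≤ x i ∧ x i < ((k i : ℝ) + 1) * mesh j at h1
  constructor <;> linarith

lemma dyadicCube_subset_fatCube (j : ℕ) (k : Fin d → ℤ) :
    (dyadicCube j k : Set (EuclideanSpace ℝ (Fin d))) ⊆ fatCube j k := fun x hx =>
  mem_fatCube_of_norm_sub_le hx (by simpa using mesh_pos j)

/-- The displacements from a dyadic cube to its `3 ^ d` neighbours, including the cube itself. -/
def displacement (e : Fin d → Fin 3) : Fin d → ℤ := fun i => (e i : ℤ) - 1

lemma fatCube_subset (j : ℕ) (k : Fin d → ℤ) :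
    (fatCube j k : Set (EuclideanSpace ℝ (Fin d))) ⊆
      ⋃ e : Fin d → Fin 3, dyadicCube j (k + displacement e) := by
  intro x hx
  have h2 : (0 : ℝ) < 2 ^ j := by positivity
  have h : ∀ i, k i - 1 ≤ cubeIndex j x i ∧ cubeIndex j x i < k i + 2 := by
    intro i
    have h1 := hx i
    rw [mesh, mul_inv_lt_iff₀ h2, lt_mul_inv_iff₀ h2] at h1
    rw [cubeIndex, Int.le_floor, Int.floor_lt]
    push_cast
    exact ⟨h1.1.le, h1.2⟩
  refine mem_iUnion.2 ⟨fun i => ⟨(cubeIndex j x i - (k i - 1)).toNat, ?_⟩, ?_⟩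
  · have := h i
    omega
  · rw [mem_dyadicCube_iff]
    funext i
    have := h i
    simp only [displacement, Pi.add_apply]
    omega

lemma norm_sub_le_of_mem_fatCube {j : ℕ} {k : Fin d → ℤ} {x y : EuclideanSpace ℝ (Fin d)}
    (hx : x ∈ fatCube j k) (hy : y ∈ fatCube j k) : ‖x - y‖ ≤ 3 * d * mesh j := by
  have hm := mesh_pos j
  rw [EuclideanSpace.norm_eq, Real.sqrt_le_left (by positivity)]
  calc ∑ i, ‖(x - y) i‖ ^ 2 ≤ ∑ i : Fin d, (3 * mesh j) ^ 2 := by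
        refine Finset.sum_le_sum fun i _ => pow_le_pow_left₀ (norm_nonneg _) ?_ 2
        rw [PiLp.sub_apply, Real.norm_eq_abs, abs_le]
        have h1 := hx i
        have h2 := hy i
        constructor <;> linarith
    _ = d * (3 * mesh j) ^ 2 := by simp
    _ ≤ (d * d) * (3 * mesh j) ^ 2 := by
        refine mul_le_mul_of_nonneg_right ?_ (by positivity)
        exact_mod_cast Nat.le_mul_self d
    _ = _ := by ring

variable (μ)

/-- The mass of the threefold enlargement of a dyadic cube. -/
def fatMass (j : ℕ) (k : Fin d → ℤ) : ℝ≥0∞ :=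
  (μ : Measure K) {y : K | (y : EuclideanSpace ℝ (Fin d)) ∈ fatCube j k}

lemma tsum_cubeMass (j : ℕ) : ∑' k, cubeMass μ j k = 1 := by
  have hm : ∀ k : Fin d → ℤ,
      MeasurableSet {y : K | (y : EuclideanSpace ℝ (Fin d)) ∈ dyadicCube j k} := fun k =>
    measurable_subtype_coe (measurableSet_dyadicCube j k)
  have hd : Pairwise (Function.onFun Disjoint fun k : Fin d → ℤ =>
      {y : K | (y : EuclideanSpace ℝ (Fin d)) ∈ dyadicCube j k}) := by
    intro k k' hkk'
    refine Set.disjoint_left.2 fun y hy hy' => hkk' ?_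
    rw [mem_ofPred_eq, mem_dyadicCube_iff] at hy hy'
    rw [← hy, ← hy']
  unfold cubeMass
  rw [← measure_iUnion hd hm, ← measure_univ (μ := (μ : Measure K))]
  congr 1
  exact eq_univ_of_forall fun y => mem_iUnion.2 ⟨_, mem_dyadicCube_iff.2 rfl⟩

lemma cubeMass_le_fatMass (j : ℕ) (k : Fin d → ℤ) : cubeMass μ j k ≤ fatMass μ j k :=
  measure_mono fun _ hy => dyadicCube_subset_fatCube j k hy

lemma fatMass_le (j : ℕ) (k : Fin d → ℤ) :
    fatMass μ j k ≤ ∑ e : Fin d → Fin 3, cubeMass μ j (k + displacement e) := by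
  refine le_trans (measure_mono ?_) (measure_iUnion_fintype_le _ _)
  intro y hy
  simpa using fatCube_subset j k hy

lemma tsum_neighbours (f : (Fin d → ℤ) → ℝ≥0∞) :
    ∑' k, ∑ e : Fin d → Fin 3, f (k + displacement e) = 3 ^ d * ∑' k, f k := by
  rw [Summable.tsum_finsetSum fun e _ => ENNReal.summable]
  have h : ∀ e : Fin d → Fin 3, ∑' k, f (k + displacement e) = ∑' k, f k := fun e =>
    (Equiv.addRight (displacement e)).tsum_eq f
  simp [h]

lemma tsum_fatMass_le (j : ℕ) : ∑' k, fatMass μ j k ≤ 3 ^ d := by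
  calc ∑' k, fatMass μ j k
      ≤ ∑' k, ∑ e : Fin d → Fin 3, cubeMass μ j (k + displacement e) :=
        ENNReal.tsum_le_tsum fun k => fatMass_le μ j k
    _ = 3 ^ d := by rw [tsum_neighbours, tsum_cubeMass, mul_one]

/-- Some neighbour of a cube carries a fixed proportion of the mass of its enlargement. -/
lemma exists_fatMass_le (j : ℕ) (k : Fin d → ℤ) : ∃ e : Fin d → Fin 3,
    fatMass μ j k ≤ 3 ^ d * cubeMass μ j (k + displacement e) := by
  obtain ⟨e, he⟩ := Finite.exists_max fun e : Fin d → Fin 3 => cubeMass μ j (k + displacement e)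
  refine ⟨e, (fatMass_le μ j k).trans ((Finset.sum_le_sum fun e' _ => he e').trans ?_)⟩
  simp

lemma finite_fatMass_ne_zero (hK : Bornology.IsBounded K) (j : ℕ) :
    {k : Fin d → ℤ | fatMass μ j k ≠ 0}.Finite := by
  obtain ⟨R, hR⟩ := hK.subset_closedBall 0
  have h2 : (0 : ℝ) < 2 ^ j := by positivity
  refine (Set.Finite.pi' fun _ : Fin d =>
    Set.finite_Icc (⌊-R * 2 ^ j⌋ - 2) (⌈R * 2 ^ j⌉ + 1)).subset fun k hk i => ?_
  obtain ⟨y, hy⟩ := nonempty_of_measure_ne_zero hk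
  have h1 := hy i
  rw [mesh, mul_inv_lt_iff₀ h2, lt_mul_inv_iff₀ h2] at h1
  have h3 : |(y : EuclideanSpace ℝ (Fin d)) i| ≤ R :=
    (PiLp.norm_apply_le _ i).trans (mem_closedBall_zero_iff.1 (hR y.2))
  rw [abs_le] at h3
  have h4 := mul_le_mul_of_nonneg_right h3.1 h2.le
  have h5 := mul_le_mul_of_nonneg_right h3.2 h2.le
  have h6 := Int.floor_le (-R * 2 ^ j : ℝ)
  have h7 := Int.le_ceil (R * 2 ^ j : ℝ)
  constructor
  · have : ((⌊-R * 2 ^ j⌋ - 2 : ℤ) : ℝ) ≤ (k i : ℤ) := by push_cast; linarith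
    exact_mod_cast this
  · have : ((k i : ℤ) : ℝ) ≤ ((⌈R * 2 ^ j⌉ + 1 : ℤ) : ℝ) := by push_cast; linarith
    exact_mod_cast this

end Spectrum

/-! ### Upper bound for the singularity spectrum -/

section UpperBound

variable {d : ℕ} {N : Seminorm ℝ (EuclideanSpace ℝ (Fin d))}
  {K : Set (EuclideanSpace ℝ (Fin d))} (μ : ProbabilityMeasure K)

/-- At a point with small local exponent, cubes of arbitrarily large generation are heavy. -/
lemma exists_heavy_fatCube {c t : ℝ} (hc : 0 < c) (hcN : ∀ x, c * ‖x‖ ≤ N x) (ht : 0 ≤ t)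
    {x : K} (hx : localHolderExponent N μ x < (t : EReal)) (J : ℕ) :
    ∃ j k, J ≤ j ∧ (x : EuclideanSpace ℝ (Fin d)) ∈ fatCube j k ∧
      ENNReal.ofReal ((c / 2) ^ t * mesh j ^ t) ≤ fatMass μ j k := by
  have hm := mesh_pos J
  have hev : ∀ᶠ r : ℝ in 𝓝[>] 0, 0 < r ∧ r < c * mesh J :=
    Ioo_mem_nhdsGT (by positivity)
  obtain ⟨r, hr, hr0, hr1⟩ := ((frequently_of_localHolderExponent_lt hx).and_eventually hev).exists
  have hrc : r / c < mesh J := by rwa [div_lt_iff₀' hc]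
  have hJ1 : mesh J ≤ 1 := by
    rw [mesh_eq]
    exact pow_le_one₀ (by norm_num) (by norm_num)
  obtain ⟨j, hj1, hj2⟩ := exists_nat_pow_near_of_lt_one (x := r / c) (y := (1 / 2 : ℝ))
    (by positivity) (hrc.le.trans hJ1) (by norm_num) (by norm_num)
  rw [← mesh_eq] at hj1 hj2
  have hJj : J ≤ j := by
    by_contra! hlt
    have : mesh J ≤ mesh (j + 1) := by
      rw [mesh_eq, mesh_eq]
      exact pow_le_pow_of_le_one (by norm_num) (by norm_num) hlt
    linarith
  have hxk : (x : EuclideanSpace ℝ (Fin d)) ∈ dyadicCube j (cubeIndex j x) :=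
    mem_dyadicCube_iff.2 rfl
  refine ⟨j, cubeIndex j x, hJj, dyadicCube_subset_fatCube _ _ hxk, ?_⟩
  refine le_trans (ENNReal.ofReal_le_ofReal ?_) (hr.trans (measure_mono fun y hy => ?_))
  · have hmj := mesh_pos j
    rw [← Real.mul_rpow (by positivity) hmj.le]
    refine Real.rpow_le_rpow (by positivity) ?_ ht
    have h1 : mesh (j + 1) = mesh j / 2 := by rw [mesh_eq, mesh_eq, pow_succ]; ring
    rw [h1, lt_div_iff₀ hc] at hj1
    linarith
  · refine mem_fatCube_of_norm_sub_le hxk (lt_of_lt_of_le ?_ hj2)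
    rw [lt_div_iff₀' hc]
    exact (hcN _).trans_lt hy

/-- The points of exponent less than `t` are covered by the enlarged cubes of mass at least a
constant times `mesh j ^ t`, of which there are at most a constant times `mesh j ^ (-t)`. -/
lemma dimH_localHolderExponent_lt_le (hN : ∀ x, N x = 0 → x = 0) {t : ℝ} (ht : 0 ≤ t) :
    dimH {x | ∃ hx : x ∈ K, localHolderExponent N μ ⟨x, hx⟩ < (t : EReal)} ≤
      ENNReal.ofReal t := by
  classical
  set A := {x | ∃ hx : x ∈ K, localHolderExponent N μ ⟨x, hx⟩ < (t : EReal)}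
  obtain ⟨c, hc, hcN⟩ := exists_le_seminorm N hN
  -- It suffices to bound the measure in every larger dimension.
  suffices h : ∀ t' : ℝ, t < t' → dimH A ≤ ENNReal.ofReal t' by
    have hcont : Tendsto (fun t' : ℝ => ENNReal.ofReal t') (𝓝[>] t) (𝓝 (ENNReal.ofReal t)) :=
      (ENNReal.continuous_ofReal.tendsto t).mono_left nhdsWithin_le_nhds
    exact ge_of_tendsto hcont (by filter_upwards [self_mem_nhdsWithin] with t' ht' using h t' ht')
  intro t' htt'
  have ht' : 0 < t' := ht.trans_lt htt'
  set D : ℝ := (3 * d) ^ t' / (c / 2) ^ t with hD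
  have hc2 : 0 < (c / 2) ^ t := by positivity
  have hD0 : 0 ≤ D := by positivity
  let heavy : ℕ → ℕ × (Fin d → ℤ) → Prop := fun J q =>
    J ≤ q.1 ∧ ENNReal.ofReal ((c / 2) ^ t * mesh q.1 ^ t) ≤ fatMass μ q.1 q.2
  let V : ℕ → ℕ × (Fin d → ℤ) → Set (EuclideanSpace ℝ (Fin d)) := fun J q =>
    if heavy J q then fatCube q.1 q.2 else ∅
  have hdiam : ∀ q : ℕ × (Fin d → ℤ),
      Metric.ediam (fatCube q.1 q.2 : Set (EuclideanSpace ℝ (Fin d))) ≤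
        ENNReal.ofReal (3 * d * mesh q.1) := by
    intro q
    refine Metric.ediam_le fun x hx y hy => ?_
    rw [edist_dist, dist_eq_norm]
    exact ENNReal.ofReal_le_ofReal (norm_sub_le_of_mem_fatCube hx hy)
  have hlim : Tendsto (fun J : ℕ => ENNReal.ofReal (3 * d * mesh J)) atTop (𝓝 0) := by
    simpa using ENNReal.tendsto_ofReal (tendsto_mesh.const_mul (3 * d : ℝ))
  have h1 := Measure.hausdorffMeasure_le_liminf_tsum t' A
    (fun J : ℕ => ENNReal.ofReal (3 * d * mesh J)) hlim V
    (Eventually.of_forall fun J q => by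
      simp only [V]
      split_ifs with hq
      · refine (hdiam q).trans (ENNReal.ofReal_le_ofReal ?_)
        refine mul_le_mul_of_nonneg_left ?_ (by positivity)
        rw [mesh_eq, mesh_eq]
        exact pow_le_pow_of_le_one (by norm_num) (by norm_num) hq.1
      · simp)
    (Eventually.of_forall fun J x ⟨hx, hx'⟩ => by
      obtain ⟨j, k, hj, hk, hm⟩ := exists_heavy_fatCube μ hc hcN ht hx' J
      refine mem_iUnion.2 ⟨(j, k), ?_⟩
      have : heavy J (j, k) := ⟨hj, hm⟩
      simpa only [V, if_pos this] using hk)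
  have hterm : ∀ J q, Metric.ediam (V J q) ^ t' ≤
      ENNReal.ofReal (D * mesh q.1 ^ (t' - t)) * fatMass μ q.1 q.2 := by
    intro J q
    have hm := mesh_pos q.1
    simp only [V]
    split_ifs with hq
    · calc Metric.ediam (fatCube q.1 q.2 : Set (EuclideanSpace ℝ (Fin d))) ^ t'
          ≤ ENNReal.ofReal (3 * d * mesh q.1) ^ t' := ENNReal.rpow_le_rpow (hdiam q) ht'.le
        _ = ENNReal.ofReal (D * mesh q.1 ^ (t' - t)) *
              ENNReal.ofReal ((c / 2) ^ t * mesh q.1 ^ t) := by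
            rw [ENNReal.ofReal_rpow_of_nonneg (by positivity) ht'.le,
              ← ENNReal.ofReal_mul (by positivity), Real.mul_rpow (by positivity) hm.le, hD,
              Real.rpow_sub hm]
            congr 1
            field_simp
        _ ≤ _ := mul_le_mul_right hq.2 _
    · simp [ht']
  have hb : (1 / 2 : ℝ) ^ (t' - t) < 1 :=
    Real.rpow_lt_one (by norm_num) (by norm_num) (sub_pos.2 htt')
  have hsum : Summable fun j : ℕ => D * mesh j ^ (t' - t) := by
    simp_rw [mesh_rpow]
    exact (summable_geometric_of_lt_one (by positivity) hb).mul_left D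
  have h2 : ∀ J, ∑' q, Metric.ediam (V J q) ^ t' ≤
      ENNReal.ofReal (∑' j : ℕ, D * mesh j ^ (t' - t)) * 3 ^ d := by
    intro J
    refine (ENNReal.tsum_le_tsum (hterm J)).trans ?_
    rw [ENNReal.tsum_prod', ENNReal.ofReal_tsum_of_nonneg (fun j => by
      have := mesh_pos j
      positivity) hsum, ← ENNReal.tsum_mul_right]
    refine ENNReal.tsum_le_tsum fun j => ?_
    change ∑' k, ENNReal.ofReal (D * mesh j ^ (t' - t)) * fatMass μ j k ≤ _
    rw [ENNReal.tsum_mul_left]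
    exact mul_le_mul_right (tsum_fatMass_le μ j) _
  have h3 : μH[t'] A ≠ ∞ := by
    refine ne_top_of_le_ne_top (b := ENNReal.ofReal (∑' j : ℕ, D * mesh j ^ (t' - t)) * 3 ^ d)
      (by finiteness) (h1.trans ?_)
    refine (liminf_le_liminf (Eventually.of_forall h2)).trans ?_
    simp
  exact dimH_le_of_hausdorffMeasure_ne_top (d := t'.toNNReal)
    (by rwa [Real.coe_toNNReal _ ht'.le])

lemma singularitySpectrum_le (hN : ∀ x, N x = 0 → x = 0) {h : ℝ} (hh : 0 ≤ h) :
    singularitySpectrum N μ (h : EReal) ≤ ENNReal.ofReal h := by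
  have hcont : Tendsto (fun t : ℝ => ENNReal.ofReal t) (𝓝[>] h) (𝓝 (ENNReal.ofReal h)) :=
    (ENNReal.continuous_ofReal.tendsto h).mono_left nhdsWithin_le_nhds
  refine ge_of_tendsto hcont ?_
  filter_upwards [self_mem_nhdsWithin] with t ht
  refine (dimH_mono ?_).trans (dimH_localHolderExponent_lt_le μ hN (hh.trans (le_of_lt ht)))
  rintro x ⟨hx, hx'⟩
  exact ⟨hx, by rw [hx']; exact_mod_cast ht⟩

end UpperBound

/-! ### Partition sums -/

section PartitionSum

variable {d : ℕ} {K : Set (EuclideanSpace ℝ (Fin d))} (μ : ProbabilityMeasure K)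

lemma ennreal_rpow_le_rpow_of_nonpos {x y : ℝ≥0∞} {z : ℝ} (hz : z ≤ 0) (h : x ≤ y) :
    y ^ z ≤ x ^ z := by
  rw [← neg_neg z, ENNReal.rpow_neg, ENNReal.rpow_neg x, ENNReal.inv_le_inv]
  exact ENNReal.rpow_le_rpow h (neg_nonneg.2 hz)

lemma partitionSum_le_tsum {q : ℝ} {j : ℕ} {g : (Fin d → ℤ) → ℝ≥0∞}
    (h : ∀ k, cubeMass μ j k ≠ 0 → cubeMass μ j k ^ q ≤ g k) :
    partitionSum μ q j ≤ ∑' k, g k := by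
  unfold partitionSum
  calc ∑' k : {k : Fin d → ℤ // cubeMass μ j k ≠ 0}, cubeMass μ j k ^ q
      ≤ ∑' k : {k : Fin d → ℤ // cubeMass μ j k ≠ 0}, g k :=
        ENNReal.tsum_le_tsum fun k => h k.1 k.2
    _ ≤ ∑' k, g k := ENNReal.tsum_comp_le_tsum_of_injective Subtype.val_injective g

lemma rpow_cubeMass_le_partitionSum {q : ℝ} {j : ℕ} {k : Fin d → ℤ} (hk : cubeMass μ j k ≠ 0) :
    cubeMass μ j k ^ q ≤ partitionSum μ q j :=
  ENNReal.le_tsum (f := fun k : {k : Fin d → ℤ // cubeMass μ j k ≠ 0} => cubeMass μ j k ^ q)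
    ⟨k, hk⟩

/-- Among `L` cubes of positive mass, at least half have mass at most `2 / L`; this bounds the
partition sums with negative exponent from below. -/
lemma le_partitionSum_of_neg {q L : ℝ} (hq : q < 0) (hL : 0 < L) {j : ℕ}
    (h : ENNReal.ofReal L ≤ partitionSum μ 0 j) :
    ENNReal.ofReal ((L / 2) ^ (1 - q)) ≤ partitionSum μ q j := by
  set a : ℝ≥0∞ := ENNReal.ofReal (2 / L) with ha
  have ha0 : a ≠ 0 := by simp [ha, hL]
  have hat : a ≠ ∞ := ENNReal.ofReal_ne_top
  have haq : a ^ q = a ^ (q - 1) * a := by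
    conv_rhs => rw [← ENNReal.rpow_one a, ← ENNReal.rpow_mul, one_mul]
    rw [← ENNReal.rpow_add _ _ ha0 hat, sub_add_cancel]
  have haq1 : a ^ (q - 1) = ENNReal.ofReal ((L / 2) ^ (1 - q)) := by
    rw [ha, ENNReal.ofReal_rpow_of_pos (by positivity), ← inv_div L 2,
      Real.inv_rpow (by positivity), ← Real.rpow_neg (by positivity), neg_sub]
  have hpt : ∀ u : ℝ≥0∞, a ^ q ≤ u ^ q + a ^ (q - 1) * u := by
    intro u
    rcases le_total u a with hu | hu
    · exact (ennreal_rpow_le_rpow_of_nonpos hq.le hu).trans le_self_add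
    · rw [haq]
      exact (mul_le_mul_right hu _).trans le_add_self
  have h1 : a ^ q * partitionSum μ 0 j ≤ partitionSum μ q j + a ^ (q - 1) := by
    calc a ^ q * partitionSum μ 0 j
        = ∑' k : {k : Fin d → ℤ // cubeMass μ j k ≠ 0}, a ^ q := by
          rw [partitionSum, ← ENNReal.tsum_mul_left]
          simp
      _ ≤ ∑' k : {k : Fin d → ℤ // cubeMass μ j k ≠ 0},
            (cubeMass μ j k ^ q + a ^ (q - 1) * cubeMass μ j k) :=
          ENNReal.tsum_le_tsum fun k => hpt _
      _ ≤ partitionSum μ q j + a ^ (q - 1) * 1 := by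
          rw [ENNReal.tsum_add, ENNReal.tsum_mul_left]
          refine add_le_add le_rfl (mul_le_mul_right ?_ _)
          rw [← tsum_cubeMass μ j]
          exact ENNReal.tsum_comp_le_tsum_of_injective Subtype.val_injective _
      _ = _ := by rw [mul_one]
  have h2 : a ^ (q - 1) + a ^ (q - 1) ≤ a ^ q * partitionSum μ 0 j := by
    refine le_trans (le_of_eq ?_) (mul_le_mul_right h (a ^ q))
    rw [haq, mul_assoc, ha, ← ENNReal.ofReal_mul (by positivity), div_mul_cancel₀ _ hL.ne',
      ENNReal.ofReal_ofNat, mul_two]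
  rw [← haq1]
  exact (ENNReal.add_le_add_iff_right (ENNReal.rpow_ne_top_of_ne_zero ha0 hat)).1 (h2.trans h1)

end PartitionSum

namespace SelfSimilarSystem

variable {d p : ℕ} (F : SelfSimilarSystem d p)

lemma exists_le_natural_fatMass : ∃ c : ℝ, 0 < c ∧ ∀ j ≠ 0, ∀ (μ : ProbabilityMeasure F.K) k,
    cubeMass μ j k ≠ 0 → ENNReal.ofReal (c * mesh j ^ F.s) ≤ fatMass F.natural j k := by
  obtain ⟨c, hc, h⟩ := F.exists_le_natural_ball
  refine ⟨c, hc, fun j hj μ k hk => ?_⟩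
  obtain ⟨y, hy⟩ := nonempty_of_measure_ne_zero hk
  refine (h _ (mesh_pos j) (mesh_lt_one hj) y).trans (measure_mono fun z hz => ?_)
  exact mem_fatCube_of_norm_sub_le hy hz

/-- Since `K` meets at most a constant times `mesh j ^ (-s)` cubes of generation `j`, the partition
sums of all measures are bounded from above for exponents in `[0, 1]`. -/
lemma exists_partitionSum_le : ∃ C : ℝ, 0 < C ∧ ∀ j ≠ 0, ∀ (μ : ProbabilityMeasure F.K) (q : ℝ),
    0 ≤ q → q ≤ 1 → partitionSum μ q j ≤ ENNReal.ofReal (C * mesh j ^ (F.s * (q - 1))) := by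
  obtain ⟨c, hc, h⟩ := F.exists_le_natural_fatMass
  refine ⟨c⁻¹ * 3 ^ d + 1, by positivity, fun j hj μ q hq0 hq1 => ?_⟩
  have hm := mesh_pos j
  set a : ℝ≥0∞ := ENNReal.ofReal (mesh j ^ F.s) with ha
  have ha0 : a ≠ 0 := by
    rw [ha, Ne, ENNReal.ofReal_eq_zero, not_le]
    positivity
  have hat : a ≠ ∞ := ENNReal.ofReal_ne_top
  have hpow : ∀ x : ℝ≥0∞, x ≠ 0 → x ≠ ∞ → x ^ q = x ^ (q - 1) * x := by
    intro x h0 ht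
    conv_rhs => rw [← ENNReal.rpow_one x, ← ENNReal.rpow_mul, one_mul]
    rw [← ENNReal.rpow_add _ _ h0 ht, sub_add_cancel]
  have hpt : ∀ k, cubeMass μ j k ≠ 0 → cubeMass μ j k ^ q ≤
      a ^ (q - 1) * (ENNReal.ofReal c⁻¹ * fatMass F.natural j k + cubeMass μ j k) := by
    intro k hk
    rcases le_total (cubeMass μ j k) a with hle | hle
    · calc cubeMass μ j k ^ q ≤ a ^ q := ENNReal.rpow_le_rpow hle hq0
        _ = a ^ (q - 1) * a := hpow a ha0 hat
        _ ≤ _ := by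
          refine mul_le_mul_right (le_trans ?_ le_self_add) _
          refine le_trans (le_of_eq ?_) (mul_le_mul_right (h j hj μ k hk) (ENNReal.ofReal c⁻¹))
          rw [← ENNReal.ofReal_mul (by positivity), inv_mul_cancel_left₀ hc.ne']
    · have ht : cubeMass μ j k ≠ ∞ := measure_ne_top _ _
      calc cubeMass μ j k ^ q = cubeMass μ j k ^ (q - 1) * cubeMass μ j k := hpow _ hk ht
        _ ≤ a ^ (q - 1) * cubeMass μ j k :=
            mul_le_mul_left (ennreal_rpow_le_rpow_of_nonpos (by linarith) hle) _
        _ ≤ _ := mul_le_mul_right le_add_self _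
  refine (partitionSum_le_tsum μ hpt).trans ?_
  rw [ENNReal.tsum_mul_left, ENNReal.tsum_add, ENNReal.tsum_mul_left, tsum_cubeMass]
  have haq : a ^ (q - 1) = ENNReal.ofReal (mesh j ^ (F.s * (q - 1))) := by
    rw [ha, ENNReal.ofReal_rpow_of_pos (by positivity), ← Real.rpow_mul hm.le]
  rw [haq, mul_comm, ENNReal.ofReal_mul (by positivity)]
  refine mul_le_mul_left ?_ _
  rw [ENNReal.ofReal_add (by positivity) zero_le_one, ENNReal.ofReal_mul (by positivity),
    ENNReal.ofReal_one, ENNReal.ofReal_pow (by norm_num), ENNReal.ofReal_ofNat]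
  gcongr
  exact tsum_fatMass_le _ _

/-- Measures whose mass on each enlarged cube of generation `j` exceeds a small proportion of the
natural mass of this cube. -/
def spreadSet (j : ℕ) : Set (ProbabilityMeasure F.K) :=
  {μ | ∀ k, fatMass F.natural j k ≠ 0 → fatMass F.natural j k / (j + 1) < fatMass μ j k}

/-- The natural measure has partition sums of order at least `mesh j ^ (s (q - 1))`, as each enlarged
cube has natural mass at most a constant times `mesh j ^ s`; measures in `F.spreadSet j` inherit this
up to a factor `j + 1`. -/
lemma exists_one_le_partitionSum : ∃ C : ℝ, 0 < C ∧ ∀ᶠ j in atTop, ∀ μ ∈ F.spreadSet j, ∀ q : ℝ,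
    0 ≤ q → q ≤ 1 →
      1 ≤ ENNReal.ofReal (C * (j + 1) * mesh j ^ (F.s * (1 - q))) * partitionSum μ q j := by
  classical
  obtain ⟨C, r₀, hC, hr₀, h⟩ := F.exists_natural_le
  set B : ℝ := C * (3 * d + 1) ^ F.s + 1 with hB
  have hB1 : 1 ≤ B := le_add_of_nonneg_left (by positivity)
  refine ⟨B * 3 ^ d * 3 ^ d, by positivity, ?_⟩
  have hlim : Tendsto (fun j => (3 * d + 1) * mesh j) atTop (𝓝 0) := by
    simpa using tendsto_mesh.const_mul (3 * d + 1 : ℝ)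
  filter_upwards [hlim.eventually (gt_mem_nhds hr₀)] with j hj μ hμ q hq0 hq1
  have hm := mesh_pos j
  have hnat : ∀ k, fatMass F.natural j k ≤ ENNReal.ofReal (B * mesh j ^ F.s) := by
    intro k
    refine (h ((3 * d + 1) * mesh j) (by positivity) hj _ (isOpen_fatCube j k).measurableSet
      fun x hx y hy => (norm_sub_le_of_mem_fatCube hx hy).trans (by linarith)).trans ?_
    refine ENNReal.ofReal_le_ofReal ?_
    rw [Real.mul_rpow (by positivity) hm.le, ← mul_assoc]
    refine mul_le_mul_of_nonneg_right ?_ (by positivity)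
    linarith
  set v : (Fin d → ℤ) → ℝ≥0∞ :=
    {k | cubeMass μ j k ≠ 0}.indicator fun k => cubeMass μ j k ^ q with hv
  have hZ : partitionSum μ q j = ∑' k, v k := by
    unfold partitionSum
    exact tsum_subtype {k | cubeMass μ j k ≠ 0} fun k => cubeMass μ j k ^ q
  have hj1 : (0 : ℝ) < j + 1 := by positivity
  have hterm : ∀ k, fatMass F.natural j k ≤
      ENNReal.ofReal (B * mesh j ^ (F.s * (1 - q)) * (3 ^ d * (j + 1))) *
        ∑ e : Fin d → Fin 3, v (k + displacement e) := by
    intro k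
    by_cases hk : fatMass F.natural j k = 0
    · simp [hk]
    have hkt : fatMass F.natural j k ≠ ∞ := measure_ne_top _ _
    obtain ⟨e, he⟩ := exists_fatMass_le μ j k
    set u := cubeMass μ j (k + displacement e)
    have h1 : fatMass F.natural j k ≤ ENNReal.ofReal (3 ^ d * (j + 1)) * u := by
      have h2 := (hμ k hk).le
      rw [ENNReal.div_le_iff (by simp) (by finiteness)] at h2
      refine (h2.trans (mul_le_mul_left he _)).trans (le_of_eq ?_)
      rw [ENNReal.ofReal_mul (by positivity), ENNReal.ofReal_pow (by norm_num),
        ENNReal.ofReal_add (by positivity) zero_le_one, ENNReal.ofReal_natCast,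
        ENNReal.ofReal_one, ENNReal.ofReal_ofNat]
      ring
    have hu : u ≠ 0 := fun hu => hk (le_antisymm (by simpa [hu] using h1) zero_le)
    have hone : (1 : ℝ) ≤ 3 ^ d * (j + 1) := by
      have h3 : (1 : ℝ) ≤ 3 ^ d := one_le_pow₀ (by norm_num)
      have h4 : (0 : ℝ) ≤ j := Nat.cast_nonneg j
      nlinarith
    have h2 : fatMass F.natural j k ^ q ≤ ENNReal.ofReal (3 ^ d * (j + 1)) * v (k + displacement e)
        := by
      have hve : v (k + displacement e) = u ^ q := Set.indicator_of_mem hu _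
      rw [hve]
      refine (ENNReal.rpow_le_rpow h1 hq0).trans ?_
      rw [ENNReal.mul_rpow_of_nonneg _ _ hq0]
      refine mul_le_mul_left ?_ _
      exact (ENNReal.rpow_le_rpow_of_exponent_le (ENNReal.one_le_ofReal.2 hone) hq1).trans_eq
        (ENNReal.rpow_one _)
    have h3 : fatMass F.natural j k ^ (1 - q) ≤
        ENNReal.ofReal (B * mesh j ^ (F.s * (1 - q))) := by
      refine (ENNReal.rpow_le_rpow (hnat k) (by linarith)).trans ?_
      rw [ENNReal.ofReal_rpow_of_nonneg (by positivity) (by linarith),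
        Real.mul_rpow (by positivity) (by positivity), ← Real.rpow_mul hm.le]
      refine ENNReal.ofReal_le_ofReal (mul_le_mul_of_nonneg_right ?_ (by positivity))
      exact (Real.rpow_le_rpow_of_exponent_le hB1 (by linarith)).trans_eq (Real.rpow_one B)
    calc fatMass F.natural j k
        = fatMass F.natural j k ^ (1 - q) * fatMass F.natural j k ^ q := by
          rw [← ENNReal.rpow_add _ _ hk hkt, sub_add_cancel, ENNReal.rpow_one]
      _ ≤ ENNReal.ofReal (B * mesh j ^ (F.s * (1 - q))) *
            (ENNReal.ofReal (3 ^ d * (j + 1)) * v (k + displacement e)) := mul_le_mul' h3 h2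
      _ = ENNReal.ofReal (B * mesh j ^ (F.s * (1 - q)) * (3 ^ d * (j + 1))) *
            v (k + displacement e) := by
          rw [← mul_assoc, ← ENNReal.ofReal_mul (by positivity)]
      _ ≤ _ := by
          refine mul_le_mul_right ?_ _
          exact Finset.single_le_sum (f := fun e => v (k + displacement e))
            (fun _ _ => zero_le) (Finset.mem_univ e)
  calc (1 : ℝ≥0∞) = ∑' k, cubeMass F.natural j k := (tsum_cubeMass _ j).symm
    _ ≤ ∑' k, ENNReal.ofReal (B * mesh j ^ (F.s * (1 - q)) * (3 ^ d * (j + 1))) *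
          ∑ e : Fin d → Fin 3, v (k + displacement e) :=
        ENNReal.tsum_le_tsum fun k => (cubeMass_le_fatMass _ j k).trans (hterm k)
    _ = ENNReal.ofReal (B * mesh j ^ (F.s * (1 - q)) * (3 ^ d * (j + 1))) *
          (ENNReal.ofReal (3 ^ d) * partitionSum μ q j) := by
        rw [ENNReal.tsum_mul_left, tsum_neighbours, hZ, ENNReal.ofReal_pow (by norm_num),
          ENNReal.ofReal_ofNat]
    _ = _ := by
        rw [← mul_assoc, ← ENNReal.ofReal_mul (by positivity)]
        congr 2
        ring

end SelfSimilarSystem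

/-! ### Residual sets of probability measures -/

section Generic

variable {X : Type*} [MetricSpace X] [MeasurableSpace X] [OpensMeasurableSpace X]

lemma isOpen_setOf_lt_measure {G : Set X} (hG : IsOpen G) (a : ℝ≥0∞) :
    IsOpen {μ : ProbabilityMeasure X | a < (μ : Measure X) G} := by
  rw [isOpen_iff_mem_nhds]
  intro μ (hμ : a < (μ : Measure X) G)
  filter_upwards [ProbabilityMeasure.toMeasure_add_pos_gt_mem_nhds μ hG
    (tsub_pos_of_lt hμ)] with ρ (hρ : _ < _ + _)
  by_contra! hle
  have h1 : (ρ : Measure X) G + ((μ : Measure X) G - a) ≤ (μ : Measure X) G :=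
    (add_le_add_left hle _).trans (add_tsub_cancel_of_le hμ.le).le
  exact absurd hρ h1.not_gt

/-- Every probability measure is a limit of mixtures which contain a prescribed sequence of
probability measures in slowly decreasing proportions. -/
lemma exists_tendsto_mixture (μ : ProbabilityMeasure X) (ν : ℕ → ProbabilityMeasure X) :
    ∃ ρ : ℕ → ProbabilityMeasure X, Tendsto ρ atTop (𝓝 μ) ∧
      ∀ (n : ℕ) A, ENNReal.ofReal (2 / (n + 2)) * (ν n : Measure X) A ≤ (ρ n : Measure X) A := by
  set c : ℕ → ℝ := fun n => 2 / (n + 2) with hc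
  have hc0 : ∀ n, 0 ≤ c n := fun n => by positivity
  have hc1 : ∀ n, 0 ≤ 1 - c n := fun n => by
    have : c n ≤ 1 := by
      rw [hc, div_le_one (by positivity)]
      linarith [(Nat.cast_nonneg n : (0 : ℝ) ≤ n)]
    linarith
  have hclim : Tendsto c atTop (𝓝 0) :=
    tendsto_const_nhds.div_atTop (tendsto_natCast_atTop_atTop.atTop_add tendsto_const_nhds)
  let ρ : ℕ → ProbabilityMeasure X := fun n =>
    ⟨ENNReal.ofReal (1 - c n) • (μ : Measure X) + ENNReal.ofReal (c n) • (ν n : Measure X), ⟨by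
      simp only [Measure.add_apply, Measure.smul_apply, measure_univ, smul_eq_mul, mul_one]
      rw [← ENNReal.ofReal_add (hc1 n) (hc0 n)]
      simp⟩⟩
  refine ⟨ρ, ?_, fun n A => ?_⟩
  · rw [ProbabilityMeasure.tendsto_iff_forall_integral_tendsto]
    intro f
    have hint : ∀ n, ∫ x, f x ∂(ρ n : Measure X) =
        (1 - c n) * ∫ x, f x ∂(μ : Measure X) + c n * ∫ x, f x ∂(ν n : Measure X) := by
      intro n
      change ∫ x, f x ∂(ENNReal.ofReal (1 - c n) • (μ : Measure X) +
        ENNReal.ofReal (c n) • (ν n : Measure X)) = _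
      rw [integral_add_measure ((f.integrable _).smul_measure ENNReal.ofReal_ne_top)
        ((f.integrable _).smul_measure ENNReal.ofReal_ne_top), integral_smul_measure,
        integral_smul_measure, ENNReal.toReal_ofReal (hc1 n), ENNReal.toReal_ofReal (hc0 n),
        smul_eq_mul, smul_eq_mul]
    simp_rw [hint]
    have h1 : Tendsto (fun n => c n * ∫ x, f x ∂(ν n : Measure X)) atTop (𝓝 0) := by
      refine hclim.zero_mul_isBoundedUnder_le ⟨‖f‖, ?_⟩
      rw [eventually_map]
      refine Eventually.of_forall fun n => ?_
      exact f.norm_integral_le_norm (ν n : Measure X)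
    have h2 : Tendsto (fun n => (1 - c n) * ∫ x, f x ∂(μ : Measure X)) atTop
        (𝓝 ((1 - 0) * ∫ x, f x ∂(μ : Measure X))) :=
      (tendsto_const_nhds.sub hclim).mul_const _
    simpa using h2.add h1
  · change _ ≤ (ENNReal.ofReal (1 - c n) • (μ : Measure X) +
      ENNReal.ofReal (c n) • (ν n : Measure X)) A
    rw [Measure.add_apply, Measure.smul_apply, Measure.smul_apply, smul_eq_mul, smul_eq_mul]
    exact le_add_self

/-- If the open set `O n` contains all probability measures that dominate a small multiple of a
fixed probability measure `ν n`, then a typical measure lies in infinitely many of the `O n`. -/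
lemma isGδ_dense_frequently [BorelSpace X] [CompactSpace X] {O : ℕ → Set (ProbabilityMeasure X)}
    (hO : ∀ n, IsOpen (O n)) (ν : ℕ → ProbabilityMeasure X)
    (h : ∀ n : ℕ, n ≠ 0 → ∀ ρ : ProbabilityMeasure X,
      (∀ A, ENNReal.ofReal (2 / (n + 2)) * (ν n : Measure X) A ≤ (ρ : Measure X) A) → ρ ∈ O n) :
    IsGδ {μ | ∃ᶠ n in atTop, μ ∈ O n} ∧ Dense {μ | ∃ᶠ n in atTop, μ ∈ O n} := by
  have heq : {μ | ∃ᶠ n in atTop, μ ∈ O n} = ⋂ m : ℕ, ⋃ n ≥ m, O n := by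
    ext μ
    simp [frequently_atTop]
  have hopen : ∀ m, IsOpen (⋃ n ≥ m, O n) := fun m =>
    isOpen_iUnion fun n => isOpen_iUnion fun _ => hO n
  rw [heq]
  refine ⟨IsGδ.iInter fun m => (hopen m).isGδ, dense_iInter_of_isOpen hopen fun m μ => ?_⟩
  obtain ⟨ρ, hρ, hρν⟩ := exists_tendsto_mixture μ ν
  refine mem_closure_of_tendsto hρ ?_
  filter_upwards [eventually_ge_atTop m, eventually_ne_atTop 0] with n hn hn0
  exact mem_iUnion₂.2 ⟨n, hn, h n hn0 _ (hρν n)⟩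

lemma div_lt_ofReal_mul {n : ℕ} (hn : n ≠ 0) {a : ℝ≥0∞} (h0 : a ≠ 0) (ht : a ≠ ∞) :
    a / (n + 1) < ENNReal.ofReal (2 / (n + 2)) * a := by
  rw [mul_comm, div_eq_mul_inv]
  refine ENNReal.mul_lt_mul_right h0 ht ?_
  have h1 : ((n : ℝ≥0∞) + 1)⁻¹ = ENNReal.ofReal ((n + 1 : ℝ)⁻¹) := by
    rw [ENNReal.ofReal_inv_of_pos (by positivity), ENNReal.ofReal_add (by positivity) zero_le_one,
      ENNReal.ofReal_natCast, ENNReal.ofReal_one]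
  rw [h1, ENNReal.ofReal_lt_ofReal_iff (by positivity), inv_eq_one_div,
    div_lt_div_iff₀ (by positivity) (by positivity)]
  have : (0 : ℝ) < n := by exact_mod_cast Nat.pos_of_ne_zero hn
  linarith

end Generic

namespace SelfSimilarSystem

variable {d p : ℕ} (F : SelfSimilarSystem d p)

/-- The measure with an atom of mass `ratio w ^ s` at the point coded by each word `w` of
length `n`, followed by the fixed letter. -/
def atoms (n : ℕ) : ProbabilityMeasure F.K :=
  ⟨F.bernoulli.map fun ω => F.point (F.extend fun j : Fin n => ω j),
    Measure.isProbabilityMeasure_map (Measurable.aemeasurable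
      ((Measurable.of_discrete (f := fun w : Fin n → Fin p => F.point (F.extend w))).comp
        (measurable_pi_lambda _ fun _ => measurable_pi_apply _)))⟩

/-- The small ball around the point coded by a finite word of length `n`, where approximations
of the atoms of `F.atoms n` have to be found. -/
def atomBall {n : ℕ} (w : Fin n → Fin p) : Set F.K :=
  {y | ‖(y : EuclideanSpace ℝ (Fin d)) - F.point (F.extend w)‖ < mesh (n ^ 2)}

lemma isOpen_atomBall {n : ℕ} (w : Fin n → Fin p) : IsOpen (F.atomBall w) :=
  isOpen_lt (by fun_prop) continuous_const

lemma le_atoms_atomBall {n : ℕ} (w : Fin n → Fin p) :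
    ENNReal.ofReal (F.ratio (F.extend w) n ^ F.s) ≤ (F.atoms n : Measure F.K) (F.atomBall w) := by
  have hm : Measurable fun ω : ℕ → Fin p => F.point (F.extend fun j : Fin n => ω j) :=
    (Measurable.of_discrete (f := fun w : Fin n → Fin p => F.point (F.extend w))).comp
      (measurable_pi_lambda _ fun _ => measurable_pi_apply _)
  change _ ≤ F.bernoulli.map (fun ω => F.point (F.extend fun j : Fin n => ω j)) _
  rw [Measure.map_apply hm (F.isOpen_atomBall w).measurableSet, ← F.bernoulli_cylinder]
  refine measure_mono fun ω hω => ?_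
  have h1 : (fun j : Fin n => ω j) = w := by
    funext j
    have := hω j j.2
    simpa [extend] using this
  have h2 : F.point (F.extend fun j : Fin n => ω j) ∈ F.atomBall w := by
    rw [h1, atomBall, mem_ofPred_eq, sub_self, norm_zero]
    exact mesh_pos _
  exact h2

/-- Measures which give, near the point coded by each word of length `n`, a mass exceeding a small
proportion of the natural mass of the corresponding piece of `K`. -/
def concentratedSet (n : ℕ) : Set (ProbabilityMeasure F.K) :=
  {μ | ∀ w : Fin n → Fin p,
    ENNReal.ofReal (F.ratio (F.extend w) n ^ F.s) / (n + 1) < (μ : Measure F.K) (F.atomBall w)}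

lemma isGδ_dense_concentrated :
    IsGδ {μ | ∃ᶠ n in atTop, μ ∈ F.concentratedSet n} ∧
      Dense {μ | ∃ᶠ n in atTop, μ ∈ F.concentratedSet n} := by
  have : CompactSpace F.K := isCompact_iff_compactSpace.1 F.selfSimilar.2.1
  refine isGδ_dense_frequently (fun n => ?_) F.atoms fun n hn ρ hρ w => ?_
  · rw [concentratedSet, Set.ofPred_forall]
    exact isOpen_iInter_of_finite fun w => isOpen_setOf_lt_measure (F.isOpen_atomBall w) _
  · have hr := F.ratio_pos (F.extend w) n
    refine (div_lt_ofReal_mul hn ?_ ENNReal.ofReal_ne_top).trans_le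
      ((mul_le_mul_right (F.le_atoms_atomBall w) _).trans (hρ _))
    rw [Ne, ENNReal.ofReal_eq_zero, not_le]
    positivity

lemma isGδ_dense_spread :
    IsGδ {μ | ∃ᶠ n in atTop, μ ∈ F.spreadSet n} ∧
      Dense {μ | ∃ᶠ n in atTop, μ ∈ F.spreadSet n} := by
  have : CompactSpace F.K := isCompact_iff_compactSpace.1 F.selfSimilar.2.1
  refine isGδ_dense_frequently (fun j => ?_) (fun _ => F.natural) fun n hn ρ hρ k hk => ?_
  · have heq : F.spreadSet j = ⋂ k ∈ {k | fatMass F.natural j k ≠ 0},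
        {μ | fatMass F.natural j k / (j + 1) < fatMass μ j k} := by
      ext μ
      simp [spreadSet]
    rw [heq]
    refine (finite_fatMass_ne_zero F.natural F.selfSimilar.2.1.isBounded j).isOpen_biInter
      fun k _ => ?_
    exact isOpen_setOf_lt_measure ((isOpen_fatCube j k).preimage continuous_subtype_val) _
  · exact (div_lt_ofReal_mul hn hk (measure_ne_top _ _)).trans_le (hρ _)

/-- The set of typical measures. -/
def typical : Set (ProbabilityMeasure F.K) :=
  {μ | ∃ᶠ n in atTop, μ ∈ F.concentratedSet n} ∩ {μ | ∃ᶠ n in atTop, μ ∈ F.spreadSet n}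

lemma isGδ_typical : IsGδ F.typical := F.isGδ_dense_concentrated.1.inter F.isGδ_dense_spread.1

lemma dense_typical : Dense F.typical := by
  have : CompactSpace F.K := isCompact_iff_compactSpace.1 F.selfSimilar.2.1
  exact F.isGδ_dense_concentrated.2.inter_of_Gδ F.isGδ_dense_concentrated.1
    F.isGδ_dense_spread.1 F.isGδ_dense_spread.2

/-! ### The `L^q` spectrum of typical measures -/

variable {F} {μ : ProbabilityMeasure F.K}

lemma frequently_le_partitionSum (hμ : ∃ᶠ n in atTop, μ ∈ F.spreadSet n) {q : ℝ} (hq0 : 0 ≤ q)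
    (hq1 : q ≤ 1) {ε : ℝ} (hε : 0 < ε) :
    ∃ᶠ j in atTop, ENNReal.ofReal (mesh j ^ (F.s * (q - 1) + ε)) ≤ partitionSum μ q j := by
  obtain ⟨C, hC, h⟩ := F.exists_one_le_partitionSum
  refine (hμ.and_eventually (h.and (eventually_mul_mesh_rpow_le_one C hε))).mono ?_
  rintro j ⟨hj, h1, h2⟩
  have hm := mesh_pos j
  calc ENNReal.ofReal (mesh j ^ (F.s * (q - 1) + ε))
      ≤ ENNReal.ofReal (mesh j ^ (F.s * (q - 1) + ε)) *
          (ENNReal.ofReal (C * (j + 1) * mesh j ^ (F.s * (1 - q))) * partitionSum μ q j) :=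
        le_mul_of_one_le_right zero_le (h1 μ hj q hq0 hq1)
    _ = ENNReal.ofReal (C * (j + 1) * mesh j ^ ε) * partitionSum μ q j := by
        rw [← mul_assoc, ← ENNReal.ofReal_mul (by positivity)]
        congr 2
        rw [mul_left_comm, ← Real.rpow_add hm]
        ring_nf
    _ ≤ 1 * partitionSum μ q j := by
        refine mul_le_mul_left ?_ _
        rw [← ENNReal.ofReal_one]
        exact ENNReal.ofReal_le_ofReal h2
    _ = _ := one_mul _

lemma lqSpectrum_eq_of_mem_Icc (hμ : ∃ᶠ n in atTop, μ ∈ F.spreadSet n) {q : ℝ} (hq0 : 0 ≤ q)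
    (hq1 : q ≤ 1) : lqSpectrum μ q = ((F.s * (q - 1) : ℝ) : EReal) := by
  refine le_antisymm (lqSpectrum_le fun ε hε => frequently_le_partitionSum hμ hq0 hq1 hε)
    (le_lqSpectrum fun ε hε => ?_)
  obtain ⟨C, hC, h⟩ := F.exists_partitionSum_le
  filter_upwards [eventually_mul_mesh_rpow_le_one C hε, eventually_ne_atTop 0] with j hj hj0
  refine (h j hj0 μ q hq0 hq1).trans (ENNReal.ofReal_le_ofReal ?_)
  have hm := mesh_pos j
  have h1 : C * mesh j ^ ε ≤ 1 := by
    refine le_trans (mul_le_mul_of_nonneg_right ?_ (by positivity)) hj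
    exact le_mul_of_one_le_right hC.le (le_add_of_nonneg_left (Nat.cast_nonneg j))
  calc C * mesh j ^ (F.s * (q - 1)) = C * mesh j ^ ε * mesh j ^ (F.s * (q - 1) - ε) := by
        rw [mul_assoc, ← Real.rpow_add hm]
        ring_nf
    _ ≤ 1 * mesh j ^ (F.s * (q - 1) - ε) := mul_le_mul_of_nonneg_right h1 (by positivity)
    _ = _ := one_mul _

lemma lqSpectrum_le_of_neg (hμ : ∃ᶠ n in atTop, μ ∈ F.spreadSet n) {q : ℝ} (hq : q < 0) :
    lqSpectrum μ q ≤ ((F.s * (q - 1) : ℝ) : EReal) := by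
  refine lqSpectrum_le fun ε hε => ?_
  set δ : ℝ := ε / (2 - q) with hδ
  have hδ0 : 0 < δ := div_pos hε (by linarith)
  refine ((frequently_le_partitionSum hμ le_rfl zero_le_one hδ0).and_eventually
    (eventually_mul_mesh_rpow_le_one (2 ^ (1 - q)) hδ0)).mono ?_
  rintro j ⟨hj, hj2⟩
  have hm := mesh_pos j
  refine le_trans (ENNReal.ofReal_le_ofReal ?_) (le_partitionSum_of_neg μ hq (by positivity) hj)
  have h2 : (2 : ℝ) ^ (1 - q) * mesh j ^ δ ≤ 1 := by
    refine le_trans (mul_le_mul_of_nonneg_right ?_ (by positivity)) hj2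
    exact le_mul_of_one_le_right (by positivity) (le_add_of_nonneg_left (Nat.cast_nonneg j))
  rw [Real.div_rpow (by positivity) (by norm_num), ← Real.rpow_mul hm.le,
    le_div_iff₀ (by positivity)]
  calc mesh j ^ (F.s * (q - 1) + ε) * 2 ^ (1 - q)
      = (2 ^ (1 - q) * mesh j ^ δ) * mesh j ^ ((F.s * (0 - 1) + δ) * (1 - q)) := by
        rw [mul_assoc, ← Real.rpow_add hm, mul_comm]
        congr 2
        rw [hδ]
        field_simp [show 2 - q ≠ 0 by linarith]
        ring
    _ ≤ 1 * mesh j ^ ((F.s * (0 - 1) + δ) * (1 - q)) :=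
        mul_le_mul_of_nonneg_right h2 (by positivity)
    _ = _ := one_mul _

/-- The scale `mesh (n ^ 2)` of the atoms is negligible compared with every power of the sizes of
the pieces coded by words of length `n`. -/
lemma eventually_mesh_sq_le (F : SelfSimilarSystem d p) {δ : ℝ} (hδ : 0 < δ) (β : ℝ) :
    ∀ᶠ n : ℕ in atTop, mesh (n ^ 2) ^ δ ≤ mesh n * (F.amin ^ n) ^ β := by
  have ha := F.amin_pos
  have hb : (1 / 2 : ℝ) ^ δ < 1 := Real.rpow_lt_one (by norm_num) (by norm_num) hδ
  have h1 := tendsto_pow_atTop_nhds_zero_of_lt_one (by positivity) hb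
  filter_upwards [h1.eventually (gt_mem_nhds (show 0 < 1 / 2 * F.amin ^ β by positivity))]
    with n hn
  rw [mesh_rpow, sq, pow_mul, mesh_eq, ← Real.rpow_natCast F.amin, ← Real.rpow_mul ha.le,
    mul_comm (n : ℝ) β, Real.rpow_mul ha.le, Real.rpow_natCast, ← mul_pow]
  exact pow_le_pow_left₀ (by positivity) hn.le n

/-- A single cube near an atom of generation `n` already carries more mass than any fixed power of the
much smaller scale `mesh (n ^ 2)`. -/
lemma lqSpectrum_nonpos (hμ : ∃ᶠ n in atTop, μ ∈ F.concentratedSet n) {q : ℝ} (hq : 0 < q) :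
    lqSpectrum μ q ≤ ((0 : ℝ) : EReal) := by
  refine lqSpectrum_le fun ε hε => ?_
  have hsq : Tendsto (fun n : ℕ => n ^ 2) atTop atTop := tendsto_pow_atTop two_ne_zero
  refine hsq.frequently ?_
  refine (hμ.and_eventually ((F.eventually_mesh_sq_le (div_pos hε hq) F.s).and
    (eventually_mul_mesh_rpow_le_one (3 ^ d) one_pos))).mono ?_
  rintro n ⟨hn, h1, h2⟩
  have ha := F.amin_pos
  have hm := mesh_pos (n ^ 2)
  have hmn := mesh_pos n
  let w : Fin n → Fin p := fun _ => F.letter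
  set x : EuclideanSpace ℝ (Fin d) := (F.point (F.extend w)).1
  have hw : ENNReal.ofReal ((F.amin ^ n) ^ F.s) / (n + 1) ≤ fatMass μ (n ^ 2)
      (cubeIndex (n ^ 2) x) := by
    refine le_trans (ENNReal.div_le_div_right (ENNReal.ofReal_le_ofReal (Real.rpow_le_rpow
      (by positivity) (F.pow_le_ratio _ _) F.s_nonneg)) _) ((hn w).le.trans (measure_mono ?_))
    intro y hy
    exact mem_fatCube_of_norm_sub_le (mem_dyadicCube_iff.2 rfl) hy
  obtain ⟨e, he⟩ := exists_fatMass_le μ (n ^ 2) (cubeIndex (n ^ 2) x)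
  set u := cubeMass μ (n ^ 2) (cubeIndex (n ^ 2) x + displacement e)
  have hn1 : (0 : ℝ) < n + 1 := by positivity
  have hu : ENNReal.ofReal (mesh (n ^ 2) ^ (ε / q)) ≤ u := by
    have h3 : ENNReal.ofReal ((F.amin ^ n) ^ F.s) ≤ ENNReal.ofReal (3 ^ d * (n + 1)) * u := by
      have h4 := hw.trans he
      rw [ENNReal.div_le_iff (by simp) (by finiteness)] at h4
      refine h4.trans (le_of_eq ?_)
      rw [ENNReal.ofReal_mul (by positivity), ENNReal.ofReal_pow (by norm_num),
        ENNReal.ofReal_add (by positivity) zero_le_one, ENNReal.ofReal_natCast,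
        ENNReal.ofReal_one, ENNReal.ofReal_ofNat]
      ring
    rw [Real.rpow_one] at h2
    calc ENNReal.ofReal (mesh (n ^ 2) ^ (ε / q))
        ≤ ENNReal.ofReal (mesh n) * ENNReal.ofReal ((F.amin ^ n) ^ F.s) := by
          rw [← ENNReal.ofReal_mul hmn.le]
          exact ENNReal.ofReal_le_ofReal h1
      _ ≤ ENNReal.ofReal (mesh n) * (ENNReal.ofReal (3 ^ d * (n + 1)) * u) :=
          mul_le_mul_right h3 _
      _ = ENNReal.ofReal (3 ^ d * (n + 1) * mesh n) * u := by
          rw [← mul_assoc, ← ENNReal.ofReal_mul hmn.le, mul_comm (mesh n)]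
      _ ≤ 1 * u := by
          refine mul_le_mul_left ?_ _
          rw [← ENNReal.ofReal_one]
          exact ENNReal.ofReal_le_ofReal h2
      _ = u := one_mul u
  have hu0 : u ≠ 0 := fun h0 => by
    rw [h0, nonpos_iff_eq_zero, ENNReal.ofReal_eq_zero, ← not_lt] at hu
    exact hu (by positivity)
  refine le_trans (le_of_eq ?_) ((ENNReal.rpow_le_rpow hu hq.le).trans
    (rpow_cubeMass_le_partitionSum μ hu0))
  rw [ENNReal.ofReal_rpow_of_nonneg (by positivity) hq.le, ← Real.rpow_mul hm.le,
    div_mul_cancel₀ _ hq.ne', zero_add]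

/-- The Legendre transform of the `L^q` spectrum of a typical measure is the identity
on `[0, s]`. -/
lemma lqLegendre_eq (hμ : μ ∈ F.typical) {h : ℝ} (h0 : 0 ≤ h) (hs : h ≤ F.s) :
    lqLegendre μ h = (h : EReal) := by
  refine le_antisymm ?_ (le_iInf fun q => ?_)
  · refine (iInf_le _ (1 : ℝ)).trans ?_
    rw [lqSpectrum_eq_of_mem_Icc hμ.2 zero_le_one le_rfl]
    simp
  -- In all cases the spectrum lies below the line of slope `h` through `(1, 0)`.
  have hle : lqSpectrum μ q ≤ ((h * (q - 1) : ℝ) : EReal) := by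
    rcases lt_or_ge q 0 with hq | hq
    · refine (lqSpectrum_le_of_neg hμ.2 hq).trans (EReal.coe_le_coe_iff.2 ?_)
      exact mul_le_mul_of_nonpos_right hs (by linarith)
    · rcases le_or_gt q 1 with hq1 | hq1
      · rw [lqSpectrum_eq_of_mem_Icc hμ.2 hq hq1]
        exact EReal.coe_le_coe_iff.2 (mul_le_mul_of_nonpos_right hs (by linarith))
      · refine (lqSpectrum_nonpos hμ.1 (by linarith)).trans (EReal.coe_le_coe_iff.2 ?_)
        exact mul_nonneg h0 (by linarith)
  calc (h : EReal) = ((q * h : ℝ) : EReal) - ((h * (q - 1) : ℝ) : EReal) := by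
        rw [← EReal.coe_sub]
        ring_nf
    _ ≤ _ := EReal.sub_le_sub le_rfl hle

end SelfSimilarSystem

namespace SelfSimilarSystem

variable {d p : ℕ} {F : SelfSimilarSystem d p} {μ : ProbabilityMeasure F.K}

/-! ### Local exponents of typical measures -/

lemma eventually_mul_amax_rpow_le_one (F : SelfSimilarSystem d p) {ε : ℝ} (hε : 0 < ε) :
    ∀ᶠ n : ℕ in atTop, ((n : ℝ) + 1) * (F.amax ^ n) ^ ε ≤ 1 := by
  have ha := F.amax_pos
  have hb : F.amax ^ ε < 1 := Real.rpow_lt_one ha.le F.amax_lt_one hε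
  have h1 := tendsto_self_mul_const_pow_of_lt_one (by positivity) hb
  have h2 := tendsto_pow_atTop_nhds_zero_of_lt_one (by positivity) hb
  have h3 := h1.add h2
  rw [add_zero] at h3
  filter_upwards [h3.eventually (gt_mem_nhds one_pos)] with n hn
  rw [← Real.rpow_natCast, ← Real.rpow_mul ha.le, mul_comm (n : ℝ) ε, Real.rpow_mul ha.le,
    Real.rpow_natCast]
  linarith

/-- Around a point which follows the fixed letter for long enough after its first `n` letters, the
measures in `F.concentratedSet n` have a large mass. -/
lemma le_measure_of_mem_concentratedSet {n : ℕ} (hμ : μ ∈ F.concentratedSet n)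
    (x : ℕ → Fin p) {ρ ε : ℝ} (hmesh : mesh (n ^ 2) ≤ ρ)
    (hdist : ‖(F.point x : EuclideanSpace ℝ (Fin d)) - F.point (F.extend fun j : Fin n => x j)‖ ≤
      F.size * ρ) (hε : 0 ≤ ε) (hn : ((n : ℝ) + 1) * (F.amax ^ n) ^ ε ≤ 1) :
    ENNReal.ofReal (F.ratio x n ^ (F.s + ε)) ≤ (μ : Measure F.K)
      {y | ‖(y : EuclideanSpace ℝ (Fin d)) - F.point x‖ < 2 * F.size * ρ} := by
  have hr := F.ratio_pos x n
  have hratio : F.ratio (F.extend fun j : Fin n => x j) n = F.ratio x n :=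
    F.ratio_congr fun i hi => F.extend_apply x hi
  have h1 := hμ fun j => x j
  rw [hratio] at h1
  have h2 : ENNReal.ofReal (F.ratio x n ^ (F.s + ε)) ≤
      ENNReal.ofReal (F.ratio x n ^ F.s) / (n + 1) := by
    rw [ENNReal.le_div_iff_mul_le (by simp) (by simp)]
    have h3 : ((n : ℝ≥0∞) + 1) = ENNReal.ofReal (n + 1) := by
      rw [ENNReal.ofReal_add (by positivity) zero_le_one, ENNReal.ofReal_natCast,
        ENNReal.ofReal_one]
    rw [h3, ← ENNReal.ofReal_mul (by positivity)]
    refine ENNReal.ofReal_le_ofReal ?_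
    rw [Real.rpow_add hr, mul_assoc]
    refine mul_le_of_le_one_right (by positivity) (le_trans ?_ hn)
    rw [mul_comm]
    exact mul_le_mul_of_nonneg_left (Real.rpow_le_rpow hr.le (F.ratio_le_pow x n) hε)
      (by positivity)
  refine h2.trans (h1.le.trans (measure_mono fun y hy => ?_))
  have h3 : ‖(y : EuclideanSpace ℝ (Fin d)) - F.point (F.extend fun j : Fin n => x j)‖ <
      mesh (n ^ 2) := hy
  have h4 := norm_sub_le_norm_sub_add_norm_sub (y : EuclideanSpace ℝ (Fin d))
    (F.point (F.extend fun j : Fin n => x j) : EuclideanSpace ℝ (Fin d))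
    (F.point x : EuclideanSpace ℝ (Fin d))
  rw [norm_sub_rev (F.point (F.extend fun j : Fin n => x j) : EuclideanSpace ℝ (Fin d))] at h4
  have h5 : ρ ≤ F.size * ρ :=
    le_mul_of_one_le_left ((mesh_pos _).le.trans hmesh) F.one_le_size
  rw [mem_ofPred_eq]
  linarith

lemma localHolderExponent_le_s {N : Seminorm ℝ (EuclideanSpace ℝ (Fin d))}
    (hμ : ∃ᶠ n in atTop, μ ∈ F.concentratedSet n) (x : F.K) :
    localHolderExponent N μ x ≤ (F.s : EReal) := by
  obtain ⟨ω, rfl⟩ := F.point_surjective x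
  have hD := F.size_pos
  refine localHolderExponent_le (C := 2 * F.size) (by positivity) fun ε hε => ?_
  have htend : Tendsto (F.ratio ω) atTop (𝓝[>] 0) :=
    tendsto_nhdsWithin_iff.2 ⟨F.tendsto_ratio ω, Eventually.of_forall fun n => F.ratio_pos ω n⟩
  refine htend.frequently ((hμ.and_eventually ((F.eventually_mesh_sq_le one_pos 1).and
    (F.eventually_mul_amax_rpow_le_one hε))).mono ?_)
  rintro n ⟨hn, h1, h2⟩
  refine le_measure_of_mem_concentratedSet hn ω ?_ ?_ hε.le h2
  · rw [Real.rpow_one, Real.rpow_one] at h1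
    refine h1.trans (le_trans ?_ (F.pow_le_ratio ω n))
    refine mul_le_of_le_one_left (pow_nonneg F.amin_pos.le n) ?_
    rw [mesh_eq]
    exact pow_le_one₀ (by norm_num) (by norm_num)
  · exact F.norm_point_sub_le fun i hi => (F.extend_apply ω hi).symm

/-! ### Random points with a prescribed local exponent -/

/-- After its first `N k` letters, a code is forced to follow the fixed letter until its ratio has
dropped to the power `β k` of the ratio of these letters, or until the next checkpoint
`N (k + 1)`. -/
def waitRule (F : SelfSimilarSystem d p) (N : ℕ → ℕ) (β : ℕ → ℝ) : ForcingRule p where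
  Forced n x := ∃ k, N k ≤ n ∧ n < N (k + 1) ∧ F.ratio x (N k) ^ β k < F.ratio x n
  congr n x y h := by
    refine exists_congr fun k => and_congr_right fun hk => ?_
    rw [F.ratio_congr h, F.ratio_congr fun i hi => h i (hi.trans_le hk)]
  measurableSet n := by
    have hm : ∀ m, Measurable fun x : ℕ → Fin p => F.ratio x m := fun m =>
      Finset.measurable_fun_prod _ fun i _ =>
        (Measurable.of_discrete (f := F.α)).comp (measurable_pi_apply i)
    have : {x : ℕ → Fin p | ∃ k, N k ≤ n ∧ n < N (k + 1) ∧ F.ratio x (N k) ^ β k < F.ratio x n} =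
        ⋃ k, {x | N k ≤ n ∧ n < N (k + 1)} ∩ {x | F.ratio x (N k) ^ β k < F.ratio x n} := by
      ext x
      simp [and_assoc]
    rw [this]
    exact MeasurableSet.iUnion fun k => (MeasurableSet.const _).inter
      (measurableSet_lt ((hm _).pow_const _) (hm _))

lemma cylBound_nonneg (G : ForcingRule p) (x : ℕ → Fin p) (n : ℕ) : 0 ≤ F.cylBound G x n :=
  Finset.prod_nonneg fun i _ => by
    split_ifs
    · exact zero_le_one
    · exact Real.rpow_nonneg (F.α_pos _).le _

open Classical in
lemma cylBound_succ (G : ForcingRule p) (x : ℕ → Fin p) (n : ℕ) :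
    F.cylBound G x (n + 1) =
      F.cylBound G x n * if G.Forced n x then 1 else F.α (x n) ^ F.s :=
  Finset.prod_range_succ _ _

lemma cylBound_antitone (G : ForcingRule p) (x : ℕ → Fin p) : Antitone (F.cylBound G x) :=
  antitone_nat_of_succ_le fun n => by
    rw [cylBound_succ]
    refine mul_le_of_le_one_right (cylBound_nonneg G x n) ?_
    split_ifs
    · exact le_rfl
    · exact Real.rpow_le_one (F.α_pos _).le (F.α_lt_one _).le F.s_nonneg

lemma cylBound_le_one (G : ForcingRule p) (x : ℕ → Fin p) (n : ℕ) : F.cylBound G x n ≤ 1 := by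
  have h : F.cylBound G x 0 = 1 := Finset.prod_range_zero _
  exact h ▸ cylBound_antitone G x (Nat.zero_le n)

/-- The conditions on the checkpoints `N k` of `F.waitRule N β` for the exponent `h`. -/
structure IsWaitSequence (F : SelfSimilarSystem d p) (μ : ProbabilityMeasure F.K) (h : ℝ)
    (N : ℕ → ℕ) (β : ℕ → ℝ) : Prop where
  strictMono : StrictMono N
  one_le : ∀ k, 1 ≤ β k
  mul_le : ∀ k, β k * h ≤ F.s
  le_mul : ∀ k, F.s ≤ β k * (h + 1 / (k + 1))
  concentrated : ∀ k, μ ∈ F.concentratedSet (N k)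
  mesh_le : ∀ k, mesh (N k ^ 2) ≤ (F.amin ^ N k) ^ β k
  pow_le : ∀ k, ((N k : ℝ) + 1) * (F.amax ^ N k) ^ (1 / ((k : ℝ) + 1)) ≤ 1
  growth : ∀ k, F.amax ^ N (k + 1) ≤ F.amin ^ ((k + 1) * (F.s + 1) * (N k * β k + 1))

/-- Choice of a sequence whose terms satisfy frequent conditions and grow as fast as desired. -/
lemma exists_seq_of_frequently {Q : ℕ → ℕ → Prop} {R : ℕ → ℕ → ℕ → Prop}
    (hQ : ∀ k, ∃ᶠ n in atTop, Q k n) (hR : ∀ k n, ∀ᶠ m in atTop, R k n m) :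
    ∃ N : ℕ → ℕ, StrictMono N ∧ (∀ k, Q k (N k)) ∧ ∀ k, R k (N k) (N (k + 1)) := by
  have h : ∀ k n, ∃ m, n < m ∧ Q (k + 1) m ∧ R k n m := fun k n => by
    obtain ⟨m, h1, h2, h3⟩ := ((hQ (k + 1)).and_eventually
      ((hR k n).and (eventually_gt_atTop n))).exists
    exact ⟨m, h3, h1, h2⟩
  choose f hf1 hf2 hf3 using h
  obtain ⟨n₀, hn₀⟩ := (hQ 0).exists
  let N : ℕ → ℕ := fun k => Nat.rec n₀ f k
  have hN : ∀ k, N (k + 1) = f k (N k) := fun k => rfl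
  refine ⟨N, strictMono_nat_of_lt_succ fun k => hN k ▸ hf1 k (N k), fun k => ?_,
    fun k => hN k ▸ hf3 k (N k)⟩
  cases k with
  | zero => exact hn₀
  | succ k => exact hN k ▸ hf2 k (N k)

lemma exists_isWaitSequence (hμ : ∃ᶠ n in atTop, μ ∈ F.concentratedSet n) {h : ℝ} (h0 : 0 ≤ h)
    (hs : h ≤ F.s) : ∃ N β, IsWaitSequence F μ h N β := by
  have ha := F.amin_pos
  set β : ℕ → ℝ := fun k => max 1 (F.s / (h + 1 / (k + 1))) with hβ
  have hpos : ∀ k : ℕ, 0 < h + 1 / ((k : ℝ) + 1) := fun k => by positivity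
  obtain ⟨N, hN1, hN2, hN3⟩ := exists_seq_of_frequently
    (Q := fun k n => μ ∈ F.concentratedSet n ∧ mesh (n ^ 2) ≤ (F.amin ^ n) ^ β k ∧
      ((n : ℝ) + 1) * (F.amax ^ n) ^ (1 / ((k : ℝ) + 1)) ≤ 1)
    (R := fun k n m => F.amax ^ m ≤ F.amin ^ ((k + 1) * (F.s + 1) * (n * β k + 1)))
    (fun k => by
      refine hμ.and_eventually (Eventually.and ?_ (F.eventually_mul_amax_rpow_le_one ?_))
      · filter_upwards [F.eventually_mesh_sq_le one_pos (β k)] with n hn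
        rw [Real.rpow_one] at hn
        refine hn.trans (mul_le_of_le_one_left (by positivity) ?_)
        rw [mesh_eq]
        exact pow_le_one₀ (by norm_num) (by norm_num)
      · positivity)
    (fun k n => (F.tendsto_amax_pow.eventually (gt_mem_nhds (by positivity))).mono
      fun _ h => h.le)
  refine ⟨N, β, hN1, fun k => le_max_left _ _, fun k => ?_, fun k => ?_, fun k => (hN2 k).1,
    fun k => (hN2 k).2.1, fun k => (hN2 k).2.2, hN3⟩
  · rcases le_total (F.s / (h + 1 / ((k : ℝ) + 1))) 1 with h1 | h1
    · simpa only [hβ, max_eq_left h1, one_mul] using hs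
    · simp only [hβ, max_eq_right h1]
      rw [div_mul_eq_mul_div, div_le_iff₀ (hpos k)]
      refine mul_le_mul_of_nonneg_left ?_ F.s_nonneg
      have : 0 ≤ 1 / ((k : ℝ) + 1) := by positivity
      linarith
  · rw [← div_le_iff₀ (hpos k)]
    exact le_max_right _ _

namespace IsWaitSequence

variable {h : ℝ} {N : ℕ → ℕ} {β : ℕ → ℝ}

lemma forced_iff (W : IsWaitSequence F μ h N β) {k n : ℕ} (h1 : N k ≤ n)
    (h2 : n < N (k + 1)) (x : ℕ → Fin p) :
    (F.waitRule N β).Forced n x ↔ F.ratio x (N k) ^ β k < F.ratio x n := by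
  refine ⟨?_, fun h => ⟨k, h1, h2, h⟩⟩
  rintro ⟨k', h1', h2', hlt⟩
  have e1 : k < k' + 1 := W.strictMono.lt_iff_lt.1 (h1.trans_lt h2')
  have e2 : k' < k + 1 := W.strictMono.lt_iff_lt.1 (h1'.trans_lt h2)
  obtain rfl : k' = k := by omega
  exact hlt

lemma rpow_le_ratio (W : IsWaitSequence F μ h N β) (x : ℕ → Fin p) (k : ℕ) :
    F.ratio x (N k) ^ β k ≤ F.ratio x (N k) :=
  (Real.rpow_le_rpow_of_exponent_ge (F.ratio_pos _ _) (F.ratio_le_one _ _) (W.one_le k)).trans_eq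
    (Real.rpow_one _)

/-- Between two checkpoints, the cylinder probabilities compare with powers of the ratio: they do
not change in the waiting phase, and later they are multiplied by `α i ^ s ≤ α i ^ h'`. -/
lemma cylBound_mul_le (W : IsWaitSequence F μ h N β) {h' : ℝ} (h0 : 0 ≤ h')
    (hs : h' ≤ F.s) (x : ℕ → Fin p) {k n : ℕ}
    (h1 : N k ≤ n) (h2 : n ≤ N (k + 1)) :
    F.cylBound (F.waitRule N β) x n * (F.ratio x (N k) ^ β k * F.amin) ^ h' ≤
      F.cylBound (F.waitRule N β) x (N k) * F.ratio x n ^ h' := by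
  classical
  set G := F.waitRule N β
  have ha := F.amin_pos
  have hr := fun m => F.ratio_pos x m
  have hθ : 0 < F.ratio x (N k) ^ β k := Real.rpow_pos_of_pos (hr _) _
  induction n, h1 using Nat.le_induction with
  | base =>
    refine mul_le_mul_of_nonneg_left (Real.rpow_le_rpow (by positivity) ?_ h0)
      (cylBound_nonneg G x _)
    exact (mul_le_of_le_one_right hθ.le F.amin_lt_one.le).trans (W.rpow_le_ratio x k)
  | succ n hn ih =>
    by_cases hf : G.Forced n x
    · refine mul_le_mul (cylBound_antitone G x (hn.trans n.le_succ)) ?_ (by positivity)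
        (cylBound_nonneg G x _)
      refine Real.rpow_le_rpow (by positivity) (le_trans ?_ (F.ratio_mul_amin_le x n)) h0
      exact mul_le_mul_of_nonneg_right ((W.forced_iff hn h2 x).1 hf).le ha.le
    · have hα := F.α_pos (x n)
      rw [cylBound_succ, if_neg hf, ratio_succ, Real.mul_rpow (hr n).le hα.le]
      calc F.cylBound G x n * F.α (x n) ^ F.s * (F.ratio x (N k) ^ β k * F.amin) ^ h'
          = F.cylBound G x n * (F.ratio x (N k) ^ β k * F.amin) ^ h' * F.α (x n) ^ F.s := by ring
        _ ≤ F.cylBound G x (N k) * F.ratio x n ^ h' * F.α (x n) ^ h' := by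
            refine mul_le_mul (ih (Nat.le_of_succ_le h2)) ?_ (by positivity)
              (mul_nonneg (cylBound_nonneg G x _) (Real.rpow_nonneg (hr n).le _))
            exact Real.rpow_le_rpow_of_exponent_ge hα (F.α_lt_one _).le hs
        _ = _ := by ring

/-- At a checkpoint, the effect of the earlier waiting phases has become negligible. -/
lemma cylBound_checkpoint_le (W : IsWaitSequence F μ h N β) (x : ℕ → Fin p) (k : ℕ) :
    F.cylBound (F.waitRule N β) x (N (k + 1)) ≤
      F.ratio x (N (k + 1)) ^ (F.s - 1 / ((k : ℝ) + 1)) := by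
  have ha := F.amin_pos
  have hs := F.s_nonneg
  have hr := fun m => F.ratio_pos x m
  have hβ := W.one_le k
  have hk : (0 : ℝ) < (k : ℝ) + 1 := by positivity
  set E : ℝ := N k * β k + 1 with hE
  have hE0 : 0 ≤ E := by positivity
  have h1 : F.amin ^ E ≤ F.ratio x (N k) ^ β k * F.amin := by
    rw [hE, Real.rpow_add ha, Real.rpow_one, Real.rpow_mul ha.le, Real.rpow_natCast]
    exact mul_le_mul_of_nonneg_right (Real.rpow_le_rpow (by positivity) (F.pow_le_ratio _ _)
      (by linarith)) ha.le
  have h2 : F.ratio x (N (k + 1)) ^ (1 / ((k : ℝ) + 1)) ≤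
      (F.ratio x (N k) ^ β k * F.amin) ^ F.s := by
    calc F.ratio x (N (k + 1)) ^ (1 / ((k : ℝ) + 1))
        ≤ (F.amin ^ ((k + 1) * (F.s + 1) * E)) ^ (1 / ((k : ℝ) + 1)) :=
          Real.rpow_le_rpow (hr _).le ((F.ratio_le_pow _ _).trans (W.growth k)) (by positivity)
      _ = F.amin ^ ((F.s + 1) * E) := by
          rw [← Real.rpow_mul ha.le]
          congr 1
          field_simp
      _ ≤ F.amin ^ (E * F.s) :=
          Real.rpow_le_rpow_of_exponent_ge ha F.amin_lt_one.le (by nlinarith)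
      _ ≤ _ := by
          rw [Real.rpow_mul ha.le]
          exact Real.rpow_le_rpow (by positivity) h1 hs
  have h3 := W.cylBound_mul_le hs le_rfl x (W.strictMono k.lt_succ_self).le le_rfl
  have h4 : F.cylBound (F.waitRule N β) x (N (k + 1)) *
      F.ratio x (N (k + 1)) ^ (1 / ((k : ℝ) + 1)) ≤ F.ratio x (N (k + 1)) ^ F.s := by
    refine (mul_le_mul_of_nonneg_left h2 (cylBound_nonneg _ x _)).trans (h3.trans ?_)
    exact mul_le_of_le_one_left (Real.rpow_nonneg (hr _).le _) (cylBound_le_one _ _ _)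
  rw [Real.rpow_sub (hr _), le_div_iff₀ (Real.rpow_pos_of_pos (hr _) _)]
  exact h4

/-- The cylinder probabilities of the waiting rule decay like every power smaller than `h`. -/
lemma exists_cylBound_le (W : IsWaitSequence F μ h N β) {h' : ℝ} (h0 : 0 < h')
    (hh : h' < h) (hs : h ≤ F.s) :
    ∃ n₀, ∀ x n, n₀ ≤ n →
      F.cylBound (F.waitRule N β) x n ≤ (F.amin ^ h')⁻¹ * F.ratio x n ^ h' := by
  have ha := F.amin_pos
  have hhpos : 0 < h := h0.trans hh
  obtain ⟨k₀, hk₀⟩ := exists_nat_one_div_lt (show 0 < F.s * (h - h') / h from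
    div_pos (mul_pos (hhpos.trans_le hs) (sub_pos.2 hh)) hhpos)
  refine ⟨N (k₀ + 1), fun x n hn => ?_⟩
  have hr := fun m => F.ratio_pos x m
  -- The last checkpoint before `n`.
  obtain ⟨k, hk, hkn, hnk⟩ : ∃ k, k₀ ≤ k ∧ N (k + 1) ≤ n ∧ n < N (k + 1 + 1) := by
    have hex : ∃ m, n < N m := ⟨n + 1, (Nat.lt_succ_self n).trans_le (W.strictMono.le_apply)⟩
    classical
    have hm := Nat.find_spec hex
    have hlt : k₀ + 1 < Nat.find hex := W.strictMono.lt_iff_lt.1 (hn.trans_lt hm)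
    obtain ⟨k, hk⟩ : ∃ k, Nat.find hex = k + 1 + 1 := ⟨Nat.find hex - 2, by omega⟩
    refine ⟨k, by omega, not_lt.1 (Nat.find_min hex (m := k + 1) (by omega)), ?_⟩
    rwa [← hk]
  have h1 := W.cylBound_mul_le h0.le (hh.le.trans hs) x hkn hnk.le
  have h2 := W.cylBound_checkpoint_le x k
  have h3 : β (k + 1) * h' ≤ F.s - 1 / ((k : ℝ) + 1) := by
    have h4 : 1 / ((k : ℝ) + 1) ≤ F.s * (h - h') / h := by
      refine le_trans ?_ hk₀.le
      exact one_div_le_one_div_of_le (by positivity) (by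
        have : (k₀ : ℝ) ≤ k := by exact_mod_cast hk
        linarith)
    have h5 : β (k + 1) ≤ F.s / h := (le_div_iff₀ hhpos).2 (W.mul_le (k + 1))
    have h6 : β (k + 1) * h' ≤ F.s / h * h' := mul_le_mul_of_nonneg_right h5 h0.le
    have h7 : F.s / h * h' = F.s - F.s * (h - h') / h := by
      field_simp
      ring
    linarith
  have hθ : 0 < F.ratio x (N (k + 1)) ^ (β (k + 1) * h') := Real.rpow_pos_of_pos (hr _) _
  have h4 : F.cylBound (F.waitRule N β) x (N (k + 1)) ≤
      F.ratio x (N (k + 1)) ^ (β (k + 1) * h') :=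
    h2.trans (Real.rpow_le_rpow_of_exponent_ge (hr _) (F.ratio_le_one _ _) h3)
  rw [Real.mul_rpow (Real.rpow_nonneg (hr _).le _) ha.le, ← Real.rpow_mul (hr _).le] at h1
  have h5 : F.ratio x (N (k + 1)) ^ (β (k + 1) * h') *
      (F.cylBound (F.waitRule N β) x n * F.amin ^ h') ≤
      F.ratio x (N (k + 1)) ^ (β (k + 1) * h') * F.ratio x n ^ h' := by
    refine le_trans (le_of_eq (by ring)) (h1.trans ?_)
    exact mul_le_mul_of_nonneg_right h4 (Real.rpow_nonneg (hr n).le _)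
  rw [inv_mul_eq_div, le_div_iff₀ (Real.rpow_pos_of_pos ha _)]
  exact le_of_mul_le_mul_left h5 hθ

/-- In each waiting phase, a forced code stays close to the point where an atom is approximated. -/
lemma norm_point_force_sub_le (W : IsWaitSequence F μ h N β) (ω : ℕ → Fin p) (k : ℕ) :
    ‖(F.point (F.force (F.waitRule N β) ω) : EuclideanSpace ℝ (Fin d)) -
      F.point (F.extend fun j : Fin (N k) => F.force (F.waitRule N β) ω j)‖ ≤
      F.size * F.ratio (F.force (F.waitRule N β) ω) (N k) ^ β k := by
  classical
  set G := F.waitRule N β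
  set x := F.force G ω with hx
  have ha := F.amin_pos
  have hs := F.s_nonneg
  set θ := F.ratio x (N k) ^ β k
  -- The ratio reaches the target before the next checkpoint.
  have hend : F.ratio x (N (k + 1)) ≤ θ := by
    refine (F.ratio_le_pow _ _).trans ((W.growth k).trans ?_)
    have h1 : (N k : ℝ) * β k ≤ (k + 1) * (F.s + 1) * (N k * β k + 1) := by
      have h2 : 0 ≤ (N k : ℝ) * β k := mul_nonneg (Nat.cast_nonneg _) (by linarith [W.one_le k])
      have h3 : (1 : ℝ) ≤ (k + 1) * (F.s + 1) := by
        have : (0 : ℝ) ≤ k := Nat.cast_nonneg k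
        nlinarith
      nlinarith
    refine (Real.rpow_le_rpow_of_exponent_ge ha F.amin_lt_one.le h1).trans ?_
    rw [Real.rpow_mul ha.le, Real.rpow_natCast]
    exact Real.rpow_le_rpow (by positivity) (F.pow_le_ratio _ _) (by linarith [W.one_le k])
  have hex : ∃ n, N k ≤ n ∧ F.ratio x n ≤ θ := ⟨N (k + 1), (W.strictMono k.lt_succ_self).le, hend⟩
  obtain ⟨hn1, hn2⟩ := Nat.find_spec hex
  have hn3 : Nat.find hex ≤ N (k + 1) :=
    Nat.find_min' hex ⟨(W.strictMono k.lt_succ_self).le, hend⟩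
  refine (F.norm_point_sub_le (n := Nat.find hex) fun i hi => ?_).trans
    (mul_le_mul_of_nonneg_left hn2 F.size_pos.le)
  by_cases hik : i < N k
  · exact (F.extend_apply x hik).symm
  · push Not at hik
    have hlt : θ < F.ratio x i := by
      by_contra! hle
      exact Nat.find_min hex hi ⟨hik, hle⟩
    have hf : G.Forced i x := (W.forced_iff hik (hi.trans_le hn3) x).2 hlt
    rw [extend, dif_neg (not_lt.2 hik), hx, force_apply, if_pos hf]

lemma localHolderExponent_force_le (W : IsWaitSequence F μ h N β)
    {M : Seminorm ℝ (EuclideanSpace ℝ (Fin d))} (ω : ℕ → Fin p) :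
    localHolderExponent M μ (F.point (F.force (F.waitRule N β) ω)) ≤ (h : EReal) := by
  set x := F.force (F.waitRule N β) ω
  have hD := F.size_pos
  have hr := fun m => F.ratio_pos x m
  refine localHolderExponent_le (C := 2 * F.size) (by positivity) fun ε hε => ?_
  set θ : ℕ → ℝ := fun k => F.ratio x (N k) ^ β k with hθ
  have hθ0 : ∀ k, 0 < θ k := fun k => Real.rpow_pos_of_pos (hr _) _
  have htend : Tendsto θ atTop (𝓝[>] 0) :=
    tendsto_nhdsWithin_iff.2 ⟨squeeze_zero (fun k => (hθ0 k).le) (W.rpow_le_ratio x)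
      ((F.tendsto_ratio x).comp W.strictMono.tendsto_atTop), Eventually.of_forall hθ0⟩
  refine htend.frequently (Eventually.frequently ?_)
  have hlim : Tendsto (fun k : ℕ => 1 / ((k : ℝ) + 1)) atTop (𝓝 0) :=
    tendsto_one_div_add_atTop_nhds_zero_nat
  filter_upwards [hlim.eventually (gt_mem_nhds (half_pos hε))] with k hk
  have hk0 : 0 ≤ 1 / ((k : ℝ) + 1) := by positivity
  have hβ := W.one_le k
  refine le_trans (ENNReal.ofReal_le_ofReal ?_) (le_measure_of_mem_concentratedSet
    (W.concentrated k) x ?_ (W.norm_point_force_sub_le ω k) hk0 (W.pow_le k))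
  · rw [hθ, ← Real.rpow_mul (hr _).le]
    refine Real.rpow_le_rpow_of_exponent_ge (hr _) (F.ratio_le_one _ _) ?_
    have h1 := W.le_mul k
    have h2 : 1 / ((k : ℝ) + 1) ≤ ε - 1 / ((k : ℝ) + 1) := by linarith
    nlinarith
  · exact (W.mesh_le k).trans (Real.rpow_le_rpow (pow_nonneg F.amin_pos.le _)
      (F.pow_le_ratio _ _) (by linarith))

end IsWaitSequence

/-! ### The singularity spectrum of typical measures -/

variable {M : Seminorm ℝ (EuclideanSpace ℝ (Fin d))}

/-- The random point with waiting phases almost surely has exponent `h`, and almost surely avoids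
sets of dimension less than `h`. -/
lemma le_singularitySpectrum (hM : ∀ x, M x = 0 → x = 0)
    (hμ : ∃ᶠ n in atTop, μ ∈ F.concentratedSet n) {h : ℝ} (h0 : 0 < h) (hs : h ≤ F.s) :
    ENNReal.ofReal h ≤ singularitySpectrum M μ (h : EReal) := by
  obtain ⟨N, β, W⟩ := exists_isWaitSequence hμ h0.le hs
  have hnull : ∀ A : Set (EuclideanSpace ℝ (Fin d)), dimH A < ENNReal.ofReal h →
      F.bernoulli {ω | (F.point (F.force (F.waitRule N β) ω) :
        EuclideanSpace ℝ (Fin d)) ∈ A} = 0 := by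
    intro A hA
    obtain ⟨t, ht, ht'⟩ := ENNReal.lt_iff_exists_nnreal_btwn.1 hA
    have hth : (t : ℝ) < h := by
      rwa [← ENNReal.ofReal_coe_nnreal, ENNReal.ofReal_lt_ofReal_iff h0] at ht'
    have ht0 : 0 < (t : ℝ) := by
      have : (0 : ℝ≥0∞) < t := (zero_le).trans_lt ht
      exact_mod_cast this
    obtain ⟨n₀, hn₀⟩ := W.exists_cylBound_le ht0 hth hs
    exact F.bernoulli_eq_zero_of_dimH_lt _ ht0
      (inv_nonneg.2 (Real.rpow_nonneg F.amin_pos.le _)) n₀ hn₀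
      (by rwa [ENNReal.ofReal_coe_nnreal])
  by_contra! hlt
  have h1 := hnull _ hlt
  let B : {q : ℚ // (0 : ℝ) ≤ q ∧ (q : ℝ) < h} → Set (ℕ → Fin p) := fun q =>
    {ω | (F.point (F.force (F.waitRule N β) ω) : EuclideanSpace ℝ (Fin d)) ∈
      {x | ∃ hx : x ∈ F.K, localHolderExponent M μ ⟨x, hx⟩ < (((q.1 : ℚ) : ℝ) : EReal)}}
  have h2 : F.bernoulli (⋃ q, B q) = 0 :=
    measure_iUnion_null fun q => hnull _ ((dimH_localHolderExponent_lt_le μ hM q.2.1).trans_lt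
      ((ENNReal.ofReal_lt_ofReal_iff h0).2 q.2.2))
  have h3 : (univ : Set (ℕ → Fin p)) ⊆ {ω | (F.point (F.force (F.waitRule N β) ω) :
      EuclideanSpace ℝ (Fin d)) ∈ levelSet M μ (h : EReal)} ∪ ⋃ q, B q := fun ω _ => by
    rcases (W.localHolderExponent_force_le (M := M) ω).lt_or_eq with hω | hω
    · obtain ⟨q, hq1, hq2⟩ := EReal.lt_iff_exists_rat_btwn.1 hω
      have hq0 : (0 : ℝ) ≤ q := by
        exact_mod_cast (localHolderExponent_nonneg M μ _).trans hq1.le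
      exact Or.inr (mem_iUnion.2 ⟨⟨q, hq0, by exact_mod_cast hq2⟩, ⟨Subtype.mem _, hq1⟩⟩)
    · exact Or.inl ⟨Subtype.mem _, hω⟩
  have h4 := (measure_mono (μ := F.bernoulli) h3).trans (measure_union_le _ _)
  rw [h1, h2, measure_univ] at h4
  simp at h4

lemma levelSet_nonempty (hM : ∀ x, M x = 0 → x = 0)
    (hμ : ∃ᶠ n in atTop, μ ∈ F.concentratedSet n) {h : ℝ} (h0 : 0 ≤ h) (hs : h ≤ F.s) :
    (levelSet M μ (h : EReal)).Nonempty := by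
  rcases h0.eq_or_lt with rfl | h0
  · obtain ⟨N, β, W⟩ := exists_isWaitSequence hμ le_rfl hs
    refine ⟨F.point (F.force (F.waitRule N β) fun _ => F.letter), Subtype.mem _, ?_⟩
    exact le_antisymm (W.localHolderExponent_force_le _)
      (by exact_mod_cast localHolderExponent_nonneg M μ _)
  · by_contra! hempty
    have h1 := le_singularitySpectrum hM hμ h0 hs
    rw [singularitySpectrum, hempty, dimH_empty, nonpos_iff_eq_zero, ENNReal.ofReal_eq_zero] at h1
    linarith

lemma singularitySpectrum_eq (hM : ∀ x, M x = 0 → x = 0)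
    (hμ : ∃ᶠ n in atTop, μ ∈ F.concentratedSet n) {h : ℝ} (h0 : 0 ≤ h) (hs : h ≤ F.s) :
    singularitySpectrum M μ (h : EReal) = ENNReal.ofReal h := by
  refine le_antisymm (singularitySpectrum_le μ hM h0) ?_
  rcases h0.eq_or_lt with rfl | h0
  · simp
  · exact le_singularitySpectrum hM hμ h0 hs

end SelfSimilarSystem

end

theorem mainTheorem1 {d p : ℕ} (hd : 1 ≤ d)
    (N : Seminorm ℝ (EuclideanSpace ℝ (Fin d))) (hN : ∀ x, N x = 0 → x = 0)
    (S : Fin p → EuclideanSpace ℝ (Fin d) → EuclideanSpace ℝ (Fin d)) (α : Fin p → ℝ)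
    (hS : ∀ i, IsContractiveSimilitude (α i) (S i))
    (hosc : OpenSetCondition S)
    (K : Set (EuclideanSpace ℝ (Fin d))) (hK : IsSelfSimilarSet S K)
    (s : ℝ≥0) (hs : dimH K = s) :
    ∃ Ω : Set (ProbabilityMeasure K), IsGδ Ω ∧ Dense Ω ∧ ∀ μ ∈ Ω,
      (∀ h : EReal, ((s : ℝ) : EReal) < h → levelSet N μ h = ∅) ∧
      (∀ h : ℝ, 0 ≤ h → h ≤ s →
        (levelSet N μ (h : EReal)).Nonempty ∧
        singularitySpectrum N μ (h : EReal) = ENNReal.ofReal h) ∧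
      (∀ q : ℝ, 0 ≤ q → q ≤ 1 → lqSpectrum μ q = (((s : ℝ) * (q - 1) : ℝ) : EReal)) ∧
      (∀ h : ℝ, 0 ≤ h → h ≤ s → MultifractalFormalismAt N μ h) := by
  have : Nonempty (Fin p) := by
    obtain ⟨x, hx⟩ := hK.1
    rw [hK.2.2] at hx
    exact ⟨(mem_iUnion.1 hx).choose⟩
  obtain ⟨t, ht0, ht⟩ := exists_sum_rpow_eq_one (fun i => (hS i).1) fun i => (hS i).2.1
  let F : SelfSimilarSystem d p := ⟨S, α, K, t, hS, hosc, hK, ht0, ht⟩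
  obtain rfl : t = s := by
    have h1 : dimH K = ENNReal.ofReal t := F.dimH_eq
    rw [hs, ← ENNReal.ofReal_coe_nnreal, eq_comm,
      ENNReal.ofReal_eq_ofReal_iff ht0 s.coe_nonneg] at h1
    exact h1
  refine ⟨F.typical, F.isGδ_typical, F.dense_typical, fun μ hμ =>
    ⟨fun h hh => ?_, fun h h0 hh => ?_, fun q hq0 hq1 => ?_, fun h h0 hh => ?_⟩⟩
  · refine eq_empty_of_forall_notMem ?_
    rintro x ⟨hx, rfl⟩
    exact hh.not_ge (SelfSimilarSystem.localHolderExponent_le_s (F := F) hμ.1 ⟨x, hx⟩)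
  · exact ⟨SelfSimilarSystem.levelSet_nonempty (F := F) hN hμ.1 h0 hh,
      SelfSimilarSystem.singularitySpectrum_eq (F := F) hN hμ.1 h0 hh⟩
  · exact SelfSimilarSystem.lqSpectrum_eq_of_mem_Icc (F := F) hμ.2 hq0 hq1
  · rw [MultifractalFormalismAt, SelfSimilarSystem.singularitySpectrum_eq (F := F) hN hμ.1 h0 hh,
      SelfSimilarSystem.lqLegendre_eq (F := F) hμ h0 hh, EReal.coe_ennreal_ofReal, max_eq_left h0]
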